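/- **Setting.** Let $\Gamma$ be a non-elementary hyperbolic group, i.e. $\Gamma$ has a finite generating set $S$ whose Cayley graph is Gromov hyperbolic, and $\Gamma$ has no cyclic subgroup of finite index. Let $\partial_\infty\Gamma$ be its Gromov boundary: the set of geodesic rays in this Cayley graph modulo finite Hausdorff distance, with its usual topology and the action of $\Gamma$ by left translation. Let $(M,d)$ be a proper metric space, $\rho:\Gamma\to\mathrm{Homeo}(M)$ a homomorphism, and $\Lambda\subset M$ a non-empty compact set with $\rho(g)(\Lambda)=\Lambda$ for all $g\in\Gamma$, no point of which is isolated in $M$. Write $B_r(x)$ for open balls and $N_r(\Lambda)$ for the open $r$-neighborhood of $\Lambda$. **Expansion.** Suppose that $\rho$ is expanding at $\Lambda$ with expansion datum $\mathcal D=(\mathcal I,\mathcal U,\Sigma,\delta,L,\lambda)$. That is: $\mathcal I$ is a finite set, $\mathcal U=\{U_\alpha\}_{\alpha\in\mathcal I}$ is a cover of $\Lambda$ by (possibly empty) open subsets of $M$, $s:\mathcal I\to\Gamma$ is a map whose image $\Sigma$ is a symmetric generating set of $\Gamma$, $L\ge\lambda>1$, and $\delta>0$ is such that for every $x\in\Lambda$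 the ball $B_\delta(x)$ is contained in some $U_\alpha$. Moreover, for each $\alpha\in\mathcal I$ the homeomorphism $h=\rho(s_\alpha^{-1})$ * is $L$-Lipschitz on $N_\delta(\Lambda)$, * satisfies $d(h(x),h(y))\ge\lambda\, d(x,y)$ for all $x,y\in U_\alpha$, and * satisfies $B_{\lambda\eta}(h(x))\subset h(B_\eta(x))$ whenever $\eta\le\delta$ and $B_\eta(x)\subset U_\alpha$. **Rays.** For $0<\eta\le\delta$ and $x\in\Lambda$, a $(\mathcal D,\eta)$-code for $x$ is a sequence $\alpha:\{0,1,2,\dots\}\to\mathcal I$ such that the points $p_0=x$, $p_{i+1}=\rho(s_{\alpha(i)}^{-1})(p_i)$ satisfy $B_\eta(p_i)\subset U_{\alpha(i)}$ for all $i\ge1$ ($\alpha(0)$ is arbitrary). Its ray is the sequence $c^\alpha_i=s_{\alpha(0)}s_{\alpha(1)}\cdots s_{\alpha(i)}$ in $\Gamma$, and $\mathrm{Ray}_x(\mathcal D,\eta)$ is the set of all such rays. **Refinements.** An expansion datum $\mathcal D'=(\mathcal I',\mathcal U',\Sigma',\delta',L',\lambda')$ of $\rho$ is a refinement of $\mathcal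 D$ if $\mathcal I\subset\mathcal I'$, $s'_\alpha=s_\alpha$ and $U_\alpha\subset U'_\alpha$ for $\alpha\in\mathcal I$, $\delta'<\delta$, $L'\ge L$ and $\lambda'\le\lambda$. **Theorem.** Suppose that there is a continuous map $f:\Lambda\to\partial_\infty\Gamma$ which is equivariant, $f(\rho(g)x)=g\,f(x)$, and nowhere constant, i.e. the image of no non-empty open subset of $\Lambda$ is a singleton. Then: 1. $\rho$ is uniformly S-hyperbolic: there is an integer $N\ge1$ such that for every $\eta\in(0,\delta]$, every $x\in\Lambda$ and all $c,c'\in\mathrm{Ray}_x(\mathcal D,\eta)$, the images of $c$ and $c'$ are within Hausdorff distance $N$ in the word metric of $\Sigma$. In particular (case $\eta=\delta$) $\rho$ is S-hyperbolic. 2. $\rho$ is meandering-hyperbolic: there are a refinement $\mathcal D'$ of $\mathcal D$ and an integer $N\ge1$ such that for every $x\in\Lambda$ any two rays in $\mathrm{Ray}_x(\mathcal D,\delta)$ lie in $\mathrm{Ray}_x(\mathcal D',\delta')$ and are equivalent under the equivalence relation on $\mathrm{Ray}_x(\mathcal D',\delta')$ generated by $c\approx c'$: there are infinite sets $P,Q$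 of indices such that $c(P)$ and $c'(Q)$ are within Hausdorff distance $N$ in the word metric of $\Sigma'$. 3. $f$ is the coding map of $\rho$: for every $x\in\Lambda$, every $c\in\mathrm{Ray}_x(\mathcal D,\delta)$ is a quasigeodesic ray in $\Gamma$, and its class in $\partial_\infty\Gamma$ is $f(x)$. -/

import Mathlib

open Set Filter Topology

namespace ExpHyp

/-! Cayley graphs, word metrics, hyperbolicity and the Gromov boundary. -/

/-- A finite generating set of a group. -/
structure FiniteGeneratingSet (Γ : Type*) [Group Γ] where
  carrier : Set Γ
  finite_carrier : carrier.Finite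
  closure_eq_top : Subgroup.closure carrier = ⊤

namespace FiniteGeneratingSet

variable {Γ : Type*} [Group Γ] (S : FiniteGeneratingSet Γ)

/-- The Cayley graph: `g` and `g * s` are joined by an edge for every generator `s`. -/
def cayleyGraph : SimpleGraph Γ := SimpleGraph.mulCayley S.carrier

/-- The word metric, that is, the graph metric of the Cayley graph on its vertex set. -/
noncomputable def wdist (g h : Γ) : ℕ := S.cayleyGraph.dist g h

theorem reachable_mul_left (a : Γ) {g h : Γ} (H : S.cayleyGraph.Reachable g h) :
    S.cayleyGraph.Reachable (a * g) (a * h) := by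
  let φ : S.cayleyGraph →g S.cayleyGraph :=
    ⟨fun x => a * x, fun {x y} hxy => SimpleGraph.mulCayley_adj_mul_iff_right.2 hxy⟩
  exact H.map φ

theorem connected_cayleyGraph : S.cayleyGraph.Connected := by
  have key : ∀ g : Γ, S.cayleyGraph.Reachable 1 g := by
    intro g
    have hg : g ∈ Subgroup.closure S.carrier := by rw [S.closure_eq_top]; trivial
    induction hg using Subgroup.closure_induction with
    | mem x hx =>
      by_cases h1 : (1 : Γ) = x
      · rw [← h1]
      · refine SimpleGraph.Adj.reachable ?_
        rw [cayleyGraph, SimpleGraph.mulCayley_adj]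
        exact ⟨h1, Or.inl (by simpa using hx)⟩
    | one => exact SimpleGraph.Reachable.refl _
    | mul x y _ _ hx hy =>
      exact hx.trans (by simpa using S.reachable_mul_left x hy)
    | inv x _ hx =>
      exact (by simpa using S.reachable_mul_left x⁻¹ hx : S.cayleyGraph.Reachable x⁻¹ 1).symm
  have : Nonempty Γ := ⟨1⟩
  exact ⟨fun g h => (key g).symm.trans (key h)⟩

theorem wdist_self (g : Γ) : S.wdist g g = 0 := SimpleGraph.dist_self

theorem wdist_triangle (g h k : Γ) : S.wdist g k ≤ S.wdist g h + S.wdist h k :=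
  S.connected_cayleyGraph.dist_triangle

theorem wdist_mul_left_le (a g h : Γ) : S.wdist (a * g) (a * h) ≤ S.wdist g h := by
  obtain ⟨w, hw⟩ := (S.connected_cayleyGraph.preconnected g h).exists_walk_length_eq_dist
  let φ : S.cayleyGraph →g S.cayleyGraph :=
    ⟨fun x => a * x, fun {x y} hxy => SimpleGraph.mulCayley_adj_mul_iff_right.2 hxy⟩
  have := SimpleGraph.dist_le (w.map φ)
  rw [SimpleGraph.Walk.length_map, hw] at this
  exact this

/-- Left translations are isometries of the word metric. -/
theorem wdist_mul_left (a g h : Γ) : S.wdist (a * g) (a * h) = S.wdist g h := by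
  refine le_antisymm (S.wdist_mul_left_le a g h) ?_
  simpa using S.wdist_mul_left_le a⁻¹ (a * g) (a * h)

/-- Two subsets of the group are within Hausdorff distance `N` in the word metric. (The word
metric is integer-valued, so all infima in the Hausdorff distance are attained.) -/
def HausdorffClose (N : ℕ) (A B : Set Γ) : Prop :=
  (∀ a ∈ A, ∃ b ∈ B, S.wdist a b ≤ N) ∧ (∀ b ∈ B, ∃ a ∈ A, S.wdist b a ≤ N)

theorem HausdorffClose.refl (A : Set Γ) : S.HausdorffClose 0 A A :=
  ⟨fun a ha => ⟨a, ha, (S.wdist_self a).le⟩, fun a ha => ⟨a, ha, (S.wdist_self a).le⟩⟩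

theorem HausdorffClose.symm {N : ℕ} {A B : Set Γ} (h : S.HausdorffClose N A B) :
    S.HausdorffClose N B A := ⟨h.2, h.1⟩

theorem HausdorffClose.trans {N K : ℕ} {A B C : Set Γ} (h : S.HausdorffClose N A B)
    (h' : S.HausdorffClose K B C) : S.HausdorffClose (N + K) A C := by
  constructor
  · intro a ha
    obtain ⟨b, hb, hab⟩ := h.1 a ha
    obtain ⟨c, hc, hbc⟩ := h'.1 b hb
    exact ⟨c, hc, (S.wdist_triangle a b c).trans (add_le_add hab hbc)⟩
  · intro c hc
    obtain ⟨b, hb, hcb⟩ := h'.2 c hc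
    obtain ⟨a, ha, hba⟩ := h.2 b hb
    have := S.wdist_triangle c b a
    exact ⟨a, ha, by omega⟩

theorem HausdorffClose.mul_left {N : ℕ} {c c' : ℕ → Γ} (a : Γ)
    (h : S.HausdorffClose N (range c) (range c')) :
    S.HausdorffClose N (range fun n => a * c n) (range fun n => a * c' n) := by
  constructor
  · rintro _ ⟨n, rfl⟩
    obtain ⟨_, ⟨m, rfl⟩, hm⟩ := h.1 (c n) ⟨n, rfl⟩
    exact ⟨_, ⟨m, rfl⟩, by simpa only [S.wdist_mul_left] using hm⟩
  · rintro _ ⟨n, rfl⟩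
    obtain ⟨_, ⟨m, rfl⟩, hm⟩ := h.2 (c' n) ⟨n, rfl⟩
    exact ⟨_, ⟨m, rfl⟩, by simpa only [S.wdist_mul_left] using hm⟩

/-- `c` restricted to `{0, …, n}` is a geodesic edge path in the Cayley graph from `x` to `y`. -/
def IsGeodesicSegment (c : ℕ → Γ) (n : ℕ) (x y : Γ) : Prop :=
  c 0 = x ∧ c n = y ∧ ∀ i j, i ≤ j → j ≤ n → S.wdist (c i) (c j) = j - i

/-- Geodesic triangles in the Cayley graph are `δ`-slim: every side is contained in the
`δ`-neighborhood of the union of the other two. (The triangles have their corners at vertices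
of the graph and the sides are edge paths. All three sides are covered, since the corners may
be permuted and geodesic segments may be reversed.) -/
def IsSlim (δ : ℕ) : Prop :=
  ∀ (x y z : Γ) (p q r : ℕ → Γ) (l m n : ℕ),
    S.IsGeodesicSegment p l x y → S.IsGeodesicSegment q m y z → S.IsGeodesicSegment r n x z →
    ∀ i ≤ l, (∃ j ≤ m, S.wdist (p i) (q j) ≤ δ) ∨ (∃ j ≤ n, S.wdist (p i) (r j) ≤ δ)

/-- The Cayley graph is hyperbolic. -/
def IsHyperbolic : Prop := ∃ δ : ℕ, S.IsSlim δ

/-- Geodesic rays in the Cayley graph issuing from a vertex, as sequences of vertices. -/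
def GeodesicRay : Type _ :=
  {c : ℕ → Γ // ∀ i j : ℕ, i ≤ j → S.wdist (c i) (c j) = j - i}

/-- Two geodesic rays are asymptotic if the Hausdorff distance of their images is finite. -/
def asymptoticSetoid : Setoid S.GeodesicRay where
  r c c' := ∃ N : ℕ, S.HausdorffClose N (range c.1) (range c'.1)
  iseqv :=
    { refl := fun _ => ⟨0, HausdorffClose.refl S _⟩
      symm := fun ⟨N, h⟩ => ⟨N, HausdorffClose.symm S h⟩
      trans := fun ⟨N, h⟩ ⟨K, h'⟩ => ⟨N + K, HausdorffClose.trans S h h'⟩ }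

/-- The Gromov boundary: asymptote classes of geodesic rays in the Cayley graph. -/
def Boundary : Type _ := Quotient S.asymptoticSetoid

/-- The class of a geodesic ray. -/
def endpoint (c : S.GeodesicRay) : S.Boundary := Quotient.mk S.asymptoticSetoid c

/-- The left translate of a geodesic ray. -/
def GeodesicRay.translate (g : Γ) (c : S.GeodesicRay) : S.GeodesicRay :=
  ⟨fun n => g * c.1 n, fun i j hij => by rw [S.wdist_mul_left]; exact c.2 i j hij⟩

/-- The group acts on its boundary by left translation of rays. -/
instance : MulAction Γ S.Boundary where
  smul g := Quotient.map (GeodesicRay.translate S g)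
    fun _ _ ⟨N, h⟩ => ⟨N, HausdorffClose.mul_left S g h⟩
  one_smul ξ := by
    induction ξ using Quotient.inductionOn with
    | h c => exact congrArg (Quotient.mk _) (Subtype.ext (funext fun n => one_mul (c.1 n)))
  mul_smul g h ξ := by
    induction ξ using Quotient.inductionOn with
    | h c => exact congrArg (Quotient.mk _) (Subtype.ext (funext fun n => mul_assoc g h (c.1 n)))

theorem smul_endpoint (g : Γ) (c : S.GeodesicRay) :
    g • S.endpoint c = S.endpoint (GeodesicRay.translate S g c) := rfl

/-- The basic neighborhood `V_n(ξ)` with parameter `k`: the classes of geodesic rays `c` from the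
identity with `d(c(n), c₀(n)) < k`, where `c₀` is a geodesic ray from the identity in the
class `ξ`. -/
def basicNhd (k n : ℕ) (ξ : S.Boundary) : Set S.Boundary :=
  {ζ | ∃ c₀ c : S.GeodesicRay, c₀.1 0 = 1 ∧ c.1 0 = 1 ∧ S.endpoint c₀ = ξ ∧ S.endpoint c = ζ ∧
    S.wdist (c.1 n) (c₀.1 n) < k}

/-- The topology of the boundary, in which the sets `V_n(ξ)`, `n → ∞`, are neighborhood bases.
If the Cayley graph is `δ`-slim, then for `k > 2δ` the set `V_m(ξ)` with parameter `k'` is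
contained in the set `V_n(ξ)` with parameter `k` as soon as `m > n + k' + δ`; so the quantifier
over `k` may be replaced by any fixed `k > 2δ` without changing the topology. -/
instance : TopologicalSpace S.Boundary where
  IsOpen U := ∀ ξ ∈ U, ∀ k : ℕ, ∀ᶠ n in atTop, S.basicNhd k n ξ ⊆ U
  isOpen_univ := fun _ _ _ => Eventually.of_forall fun _ => subset_univ _
  isOpen_inter := fun U V hU hV ξ hξ k => by
    filter_upwards [hU ξ hξ.1 k, hV ξ hξ.2 k] with n h h' using subset_inter h h'
  isOpen_sUnion := fun 𝒰 h𝒰 ξ ⟨U, hU, hξ⟩ k => by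
    filter_upwards [h𝒰 U hU ξ hξ k] with n h using h.trans (subset_sUnion_of_mem hU)

/-- Quasigeodesic rays in the group with its word metric. -/
def IsQuasigeodesicRay (c : ℕ → Γ) : Prop :=
  ∃ A C : ℝ, 1 ≤ A ∧ 0 ≤ C ∧ ∀ i j : ℕ,
    1 / A * |(i : ℝ) - j| - C ≤ S.wdist (c i) (c j) ∧
      (S.wdist (c i) (c j) : ℝ) ≤ A * |(i : ℝ) - j| + C

/-- The sequence `c` is a quasigeodesic ray whose equivalence class is the boundary point `ξ`. -/
def Represents (c : ℕ → Γ) (ξ : S.Boundary) : Prop :=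
  S.IsQuasigeodesicRay c ∧
    ∃ r : S.GeodesicRay, S.endpoint r = ξ ∧ ∃ N : ℕ, S.HausdorffClose N (range c) (range r.1)

end FiniteGeneratingSet

/-- A group is elementary if it contains a cyclic subgroup of finite index. -/
def IsElementary (Γ : Type*) [Group Γ] : Prop :=
  ∃ H : Subgroup Γ, IsCyclic H ∧ H.FiniteIndex

/-! Expanding actions. -/

/-- `f` is `(lam, U)`-expanding. -/
def IsExpandingOn {M : Type*} [MetricSpace M] (f : M ≃ₜ M) (lam : ℝ) (U : Set M) : Prop :=
  ∀ x ∈ U, ∀ y ∈ U, lam * dist x y ≤ dist (f x) (f y)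

/-- `f` is `(lam, U; δ)`-expanding. -/
def IsExpandingOnScale {M : Type*} [MetricSpace M] (f : M ≃ₜ M) (lam : ℝ) (U : Set M)
    (δ : ℝ) : Prop :=
  IsExpandingOn f lam U ∧ ∀ (x : M) (η : ℝ), η ≤ δ → Metric.ball x η ⊆ U →
    Metric.ball (f x) (lam * η) ⊆ f '' Metric.ball x η

/-- An expansion datum of an action `ρ` at the subset `Λ`. -/
structure ExpansionDatum {Γ M : Type*} [Group Γ] [MetricSpace M] (ρ : Γ →* (M ≃ₜ M))
    (Λ : Set M) where
  /-- the finite index set -/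
  I : Type
  finite_I : Finite I
  /-- the members of the cover, possibly empty -/
  U : I → Set M
  isOpen_U : ∀ a, IsOpen (U a)
  subset_iUnion : Λ ⊆ ⋃ a, U a
  s : I → Γ
  L : ℝ
  lam : ℝ
  δ : ℝ
  lam_le_L : lam ≤ L
  one_lt_lam : 1 < lam
  δ_pos : 0 < δ
  /-- `δ` is at most the supremum of the Lebesgue numbers of the cover; since the cover is finite,
  this says that `δ` is itself a Lebesgue number -/
  lebesgue : ∀ x ∈ Λ, ∃ a, Metric.ball x δ ⊆ U a
  lipschitz : ∀ a, ∀ x ∈ Metric.thickening δ Λ, ∀ y ∈ Metric.thickening δ Λ,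
    dist (ρ (s a)⁻¹ x) (ρ (s a)⁻¹ y) ≤ L * dist x y
  expanding : ∀ a, IsExpandingOnScale (ρ (s a)⁻¹) lam (U a) δ
  symmetric : ∀ a, ∃ b, s b = (s a)⁻¹
  generates : Subgroup.closure (range s) = ⊤

namespace ExpansionDatum

variable {Γ M : Type*} [Group Γ] [MetricSpace M] {ρ : Γ →* (M ≃ₜ M)} {Λ : Set M}

/-- The finite symmetric generating set `Σ` of an expansion datum. -/
def gens (D : ExpansionDatum ρ Λ) : FiniteGeneratingSet Γ where
  carrier := range D.s
  finite_carrier := by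
    have := D.finite_I
    exact finite_range D.s
  closure_eq_top := D.generates

/-- The orbit `p₀ = x`, `p_{i+1} = ρ(s_{α(i)}⁻¹)(p_i)` determined by `x` and `α`. -/
def orbit (D : ExpansionDatum ρ Λ) (α : ℕ → D.I) (x : M) : ℕ → M
  | 0 => x
  | i + 1 => ρ (D.s (α i))⁻¹ (D.orbit α x i)

/-- `α` is a `(D, η)`-code for `x`; the initial letter `α(0)` is arbitrary. -/
def IsCode (D : ExpansionDatum ρ Λ) (η : ℝ) (x : M) (α : ℕ → D.I) : Prop :=
  ∀ i, 1 ≤ i → Metric.ball (D.orbit α x i) η ⊆ D.U (α i)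

/-- The sequence `c^α_i = s_{α(0)} s_{α(1)} ⋯ s_{α(i)}`. -/
def ray (D : ExpansionDatum ρ Λ) (α : ℕ → D.I) : ℕ → Γ
  | 0 => D.s (α 0)
  | i + 1 => D.ray α i * D.s (α (i + 1))

/-- The set `Ray_x(D, η)` of the rays associated to `(D, η)`-codes for `x`. -/
def rays (D : ExpansionDatum ρ Λ) (η : ℝ) (x : M) : Set (ℕ → Γ) :=
  {c | ∃ α, D.IsCode η x α ∧ D.ray α = c}

/-- Two rays fellow-travel: their images are within Hausdorff distance `N` in the word metric. -/
def FellowTravel (D : ExpansionDatum ρ Λ) (N : ℕ) (c c' : ℕ → Γ) : Prop :=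
  D.gens.HausdorffClose N (range c) (range c')

/-- The relation `≈`: the images of some infinite subsets of the parameters are within Hausdorff
distance `N`. -/
def Approx (D : ExpansionDatum ρ Λ) (N : ℕ) (c c' : ℕ → Γ) : Prop :=
  ∃ P Q : Set ℕ, P.Infinite ∧ Q.Infinite ∧ D.gens.HausdorffClose N (c '' P) (c' '' Q)

/-- `(D, η; N)`-equivalence: the equivalence relation on `Ray_x(D, η)` generated by `≈`. -/
def RayEquiv (D : ExpansionDatum ρ Λ) (η : ℝ) (x : M) (N : ℕ) (c c' : D.rays η x) : Prop :=
  Relation.EqvGen (fun a b : D.rays η x => D.Approx N a.1 b.1) c c'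

/-- The action is S-hyperbolic with respect to the datum `D`. -/
def IsSHyperbolic (D : ExpansionDatum ρ Λ) : Prop :=
  ∃ N : ℕ, 1 ≤ N ∧ ∀ x ∈ Λ, ∀ c ∈ D.rays D.δ x, ∀ c' ∈ D.rays D.δ x, D.FellowTravel N c c'

/-- The action is uniformly S-hyperbolic with respect to the datum `D`. -/
def IsUniformlySHyperbolic (D : ExpansionDatum ρ Λ) : Prop :=
  ∃ N : ℕ, 1 ≤ N ∧ ∀ η, 0 < η → η ≤ D.δ → ∀ x ∈ Λ,
    ∀ c ∈ D.rays η x, ∀ c' ∈ D.rays η x, D.FellowTravel N c c'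

/-- `D₁` is a refinement of `D₀`: the index set `I₀` is a subset of `I₁` (up to an injection),
with the same group elements and smaller members of the cover. -/
def Refines (D₁ D₀ : ExpansionDatum ρ Λ) : Prop :=
  (∃ ι : D₀.I → D₁.I, Function.Injective ι ∧ (∀ a, D₁.s (ι a) = D₀.s a) ∧
    ∀ a, D₀.U a ⊆ D₁.U (ι a)) ∧
  D₁.δ < D₀.δ ∧ D₀.L ≤ D₁.L ∧ D₁.lam ≤ D₀.lam

/-- The action is meandering-hyperbolic with respect to the datum `D₀`: there are a refinement `D`
and `N ≥ 1` such that for every `x ∈ Λ` all rays in `Ray_x(D₀, δ₀)` are `(D, δ; N)`-equivalent as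
rays in `Ray_x(D, δ)`. -/
def IsMeanderingHyperbolic (D₀ : ExpansionDatum ρ Λ) : Prop :=
  ∃ (D : ExpansionDatum ρ Λ) (N : ℕ), D.Refines D₀ ∧ 1 ≤ N ∧ ∀ x ∈ Λ,
    ∀ c ∈ D₀.rays D₀.δ x, ∀ c' ∈ D₀.rays D₀.δ x,
      ∃ (h : c ∈ D.rays D.δ x) (h' : c' ∈ D.rays D.δ x), D.RayEquiv D.δ x N ⟨c, h⟩ ⟨c', h'⟩

/-- `π` is the coding map: the value at `x ∈ Λ` is the class of every ray in `Ray_x(D₀, δ₀)`.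
As that set of rays is never empty, there is at most one such map. -/
def IsCodingMap (D₀ : ExpansionDatum ρ Λ) (S : FiniteGeneratingSet Γ) (π : Λ → S.Boundary) :
    Prop :=
  ∀ x : Λ, ∀ c ∈ D₀.rays D₀.δ (x : M), S.Represents c (π x)

end ExpansionDatum

/-- The image of every nonempty open set is not a singleton. -/
def NowhereConstant {X Y : Type*} [TopologicalSpace X] (f : X → Y) : Prop :=
  ∀ U : Set X, IsOpen U → U.Nonempty → ∀ y, f '' U ≠ {y}

end ExpHyp

/-! ### Word metrics, slim triangles and the four-point inequality. -/

namespace ExpHyp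
namespace FiniteGeneratingSet

variable {Γ : Type*} [Group Γ] (S : FiniteGeneratingSet Γ)

/-! Expansion and hyperbolicity control a ray of a code for `x` from two sides, and the map `f` ties
them together.

Every such ray is a quasigeodesic with constants independent of `x`, the code and `η`. Following a
code for `k` letters expands small distances by at least `lam ^ k`, while the same group element, of
word length `d`, stretches small distances by at most `L ^ d`. Since points of `Λ` are not isolated,
the two rates can be compared, and `d` is at least a fixed multiple of `k` (`IsCode.lam_pow_le`). By
stability of quasigeodesics the ray is uniformly close to a geodesic ray `r`
(`FourPoint.exists_geodesicRay`).

The point is that `r` ends at `f x` (`IsCode.eq_endpoint`). Suppose not. The inverses of elements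
`g` far along the ray then contract some neighborhood `V` of `f x`
(`FourPoint.exists_isOpen_contracting`). But `ρ g` maps a ball of fixed radius about the current
orbit point into a tiny ball about `x` (`IsCode.dist_ray_apply_lt`), so by equivariance and
continuity `g` maps the `f`-image of that ball into `V`. Applying `g⁻¹` makes this `f`-image
arbitrarily small; at a limit of the orbit points `f` would be locally constant, which is excluded.

Hence any two rays for `x` are close to geodesic rays with the same endpoint and nearby origins, and
such geodesics are uniformly close. This yields uniform S-hyperbolicity and the coding map;
meandering-hyperbolicity follows on merely halving `δ`.

Hyperbolicity is used through the four-point inequality, which turns geometric arguments into linear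
arithmetic with integers. -/

theorem wdist_comm (g h : Γ) : S.wdist g h = S.wdist h g := SimpleGraph.dist_comm

theorem wdist_mul_generator_le {s : Γ} (hs : s ∈ S.carrier) (g : Γ) : S.wdist g (g * s) ≤ 1 := by
  by_cases h : g = g * s
  · rw [← h, S.wdist_self]; exact Nat.zero_le 1
  · refine (SimpleGraph.dist_eq_one_iff_adj.2 ?_).le
    rw [cayleyGraph, SimpleGraph.mulCayley_adj']
    exact ⟨h, s, hs, Or.inl rfl⟩

/-- Unit steps bound the length of each of the three pieces cut off by `i` and `j` from above; a
shortcut in the middle piece would make the total less than `n`. -/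
theorem isGeodesicSegment_of_steps {c : ℕ → Γ} {n : ℕ}
    (hc : ∀ i < n, S.wdist (c i) (c (i + 1)) ≤ 1) (hn : n ≤ S.wdist (c 0) (c n)) :
    S.IsGeodesicSegment c n (c 0) (c n) := by
  have up : ∀ i k, i + k ≤ n → S.wdist (c i) (c (i + k)) ≤ k := by
    intro i k
    induction k with
    | zero => intro _; simp [S.wdist_self]
    | succ k ih =>
      intro h
      have h1 := ih (by omega)
      have h2 := hc (i + k) (by omega)
      have h3 := S.wdist_triangle (c i) (c (i + k)) (c (i + k + 1))
      rw [← add_assoc]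
      omega
  refine ⟨rfl, rfl, fun i j hij hj => ?_⟩
  have h1 := up 0 i (by omega)
  have h2 := up i (j - i) (by omega)
  have h3 := up j (n - j) (by omega)
  rw [zero_add] at h1
  rw [Nat.add_sub_cancel' hij] at h2
  rw [Nat.add_sub_cancel' hj] at h3
  have h4 := S.wdist_triangle (c 0) (c i) (c n)
  have h5 := S.wdist_triangle (c i) (c j) (c n)
  omega

theorem isGeodesicSegment_getVert {x y : Γ} (w : S.cayleyGraph.Walk x y)
    (hw : w.length = S.wdist x y) : S.IsGeodesicSegment w.getVert w.length x y := by
  have h := S.isGeodesicSegment_of_steps (c := w.getVert) (n := w.length)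
    (fun i hi => (SimpleGraph.dist_eq_one_iff_adj.2 (w.adj_getVert_succ hi)).le)
    (by rw [w.getVert_zero, w.getVert_length, hw])
  rwa [w.getVert_zero, w.getVert_length] at h

theorem exists_isGeodesicSegment (x y : Γ) : ∃ c, S.IsGeodesicSegment c (S.wdist x y) x y := by
  obtain ⟨w, hw⟩ := (S.connected_cayleyGraph.preconnected x y).exists_walk_length_eq_dist
  exact ⟨w.getVert, by simpa [wdist, hw] using S.isGeodesicSegment_getVert w hw⟩

/-- A point on a geodesic side is reached by a geodesic edge path. -/
theorem exists_isGeodesicSegment_through {x y u : Γ}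
    (hu : S.wdist x u + S.wdist u y = S.wdist x y) :
    ∃ c, S.IsGeodesicSegment c (S.wdist x y) x y ∧ c (S.wdist x u) = u := by
  obtain ⟨w, hw⟩ := (S.connected_cayleyGraph.preconnected x u).exists_walk_length_eq_dist
  obtain ⟨v, hv⟩ := (S.connected_cayleyGraph.preconnected u y).exists_walk_length_eq_dist
  have hl : (w.append v).length = S.wdist x y := by
    rw [SimpleGraph.Walk.length_append, hw, hv]; exact hu
  refine ⟨(w.append v).getVert, ?_, ?_⟩
  · have := S.isGeodesicSegment_getVert _ hl
    rwa [hl] at this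
  · rw [SimpleGraph.Walk.getVert_append]
    simp [wdist, hw]

theorem finite_closedBall (g : Γ) (n : ℕ) : {h | S.wdist g h ≤ n}.Finite := by
  induction n with
  | zero =>
    refine (finite_singleton g).subset fun h hh => ?_
    have : S.cayleyGraph.dist g h = 0 := Nat.le_zero.1 hh
    exact (S.connected_cayleyGraph.dist_eq_zero_iff.1 this).symm
  | succ n ih =>
    have hfin := (ih.mul (S.finite_carrier.union S.finite_carrier.inv)).union ih
    refine hfin.subset fun h hh => ?_
    rcases Nat.lt_or_ge n (S.wdist g h) with hlt | hle
    · left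
      obtain ⟨c, h0, hn, hc⟩ := S.exists_isGeodesicSegment g h
      have hh' : S.wdist g h = n + 1 := le_antisymm hh hlt
      rw [hh'] at hn hc
      have h1 := hc 0 n (Nat.zero_le n) (Nat.le_succ n)
      have h2 := hc n (n + 1) (Nat.le_succ n) le_rfl
      rw [h0] at h1
      rw [hn, Nat.add_sub_cancel_left] at h2
      have hadj := SimpleGraph.dist_eq_one_iff_adj.1 h2
      rw [cayleyGraph, SimpleGraph.mulCayley_adj'] at hadj
      obtain ⟨-, s, hs, hs'⟩ := hadj
      refine ⟨c n, by simp [h1], (c n)⁻¹ * h, ?_, by simp⟩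
      rcases hs' with hs' | hs'
      · left; rw [← hs']; simpa using hs
      · right; rw [hs']; simpa using hs
    · right; exact hle

/-- The word metrics of two finite generating sets are comparable. -/
theorem exists_wdist_le_mul (T : FiniteGeneratingSet Γ) :
    ∃ K : ℕ, ∀ g h, S.wdist g h ≤ K * T.wdist g h := by
  obtain ⟨K, hK⟩ : ∃ K : ℕ, ∀ s ∈ T.carrier, S.wdist 1 s ≤ K := by
    obtain ⟨K, hK⟩ := (T.finite_carrier.image (S.wdist 1)).bddAbove
    exact ⟨K, fun s hs => hK ⟨s, hs, rfl⟩⟩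
  have hstep : ∀ g h, T.cayleyGraph.Adj g h → S.wdist g h ≤ K := by
    intro g h hgh
    rw [cayleyGraph, SimpleGraph.mulCayley_adj'] at hgh
    obtain ⟨-, s, hs, rfl | rfl⟩ := hgh
    · simpa using (S.wdist_mul_left g 1 s).le.trans (hK s hs)
    · rw [S.wdist_comm]
      simpa using (S.wdist_mul_left h 1 s).le.trans (hK s hs)
  have hwalk : ∀ {g h : Γ} (w : T.cayleyGraph.Walk g h), S.wdist g h ≤ K * w.length := by
    intro g h w
    induction w with
    | nil => simp [S.wdist_self]
    | cons hadj w ih =>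
      rw [SimpleGraph.Walk.length_cons, mul_add, mul_one]
      have h1 := hstep _ _ hadj
      have h2 := S.wdist_triangle _ _ _ |>.trans (add_le_add h1 ih)
      omega
  refine ⟨K, fun g h => ?_⟩
  obtain ⟨w, hw⟩ := (T.connected_cayleyGraph.preconnected g h).exists_walk_length_eq_dist
  have := hwalk w
  rwa [hw] at this

/-- Gromov's four-point inequality, in terms of distances. -/
def FourPoint (E : ℕ) : Prop :=
  ∀ w x y z : Γ, S.wdist x z + S.wdist w y ≤ S.wdist x y + S.wdist w z + E ∨
    S.wdist x z + S.wdist w y ≤ S.wdist y z + S.wdist w x + E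

variable {S}

/-- Slimness freed from parametrized sides: "on a side" becomes equality in the triangle inequality,
which suffices because a geodesic can be drawn through any such point. -/
theorem IsSlim.exists_close {δ : ℕ} (hS : S.IsSlim δ) {x y u : Γ}
    (hu : S.wdist x u + S.wdist u y = S.wdist x y) (z : Γ) :
    (∃ v, S.wdist y v + S.wdist v z = S.wdist y z ∧ S.wdist u v ≤ δ) ∨
      ∃ v, S.wdist x v + S.wdist v z = S.wdist x z ∧ S.wdist u v ≤ δ := by
  have between : ∀ {c : ℕ → Γ} {n j : ℕ} {a b : Γ}, S.IsGeodesicSegment c n a b → j ≤ n →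
      S.wdist a (c j) + S.wdist (c j) b = S.wdist a b := by
    rintro c n j a b ⟨rfl, rfl, hc⟩ hj
    rw [hc 0 j (Nat.zero_le _) hj, hc j n hj le_rfl, hc 0 n (Nat.zero_le _) le_rfl]
    omega
  obtain ⟨p, hp, hpu⟩ := S.exists_isGeodesicSegment_through hu
  obtain ⟨q, hq⟩ := S.exists_isGeodesicSegment y z
  obtain ⟨r, hr⟩ := S.exists_isGeodesicSegment x z
  rcases hS x y z p q r _ _ _ hp hq hr (S.wdist x u) (by omega) with ⟨j, hj, h⟩ | ⟨j, hj, h⟩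
  · left; exact ⟨q j, between hq hj, by rwa [hpu] at h⟩
  · right; exact ⟨r j, between hr hj, by rwa [hpu] at h⟩

/-- Every side of a slim triangle has a point close to both other sides. -/
theorem IsSlim.exists_near_geodesic {δ : ℕ} (hS : S.IsSlim δ) (w x z : Γ) :
    ∃ u, S.wdist x u + S.wdist u z = S.wdist x z ∧
      2 * S.wdist w u + S.wdist x z ≤ S.wdist w x + S.wdist w z + (4 * δ + 2) := by
  obtain ⟨p, h0, hl, hp⟩ := S.exists_isGeodesicSegment x z
  set l := S.wdist x z with hldef
  have hbtw : ∀ i ≤ l, S.wdist x (p i) = i ∧ S.wdist (p i) z = l - i := fun i hi => by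
    have h1 := hp 0 i (Nat.zero_le i) hi
    have h2 := hp i l hi le_rfl
    rw [h0] at h1
    rw [hl] at h2
    exact ⟨by omega, h2⟩
  have hnear : ∀ i ≤ l, (S.wdist z (p i) + S.wdist w (p i) ≤ S.wdist w z + 2 * δ) ∨
      S.wdist x (p i) + S.wdist w (p i) ≤ S.wdist w x + 2 * δ := by
    intro i hi
    have hb := hbtw i hi
    rcases hS.exists_close (x := x) (y := z) (u := p i) (by omega) w with
      ⟨v, hv, huv⟩ | ⟨v, hv, huv⟩
    · left
      have h1 := S.wdist_triangle z v (p i)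
      have h2 := S.wdist_triangle w v (p i)
      rw [S.wdist_comm v (p i)] at h1 h2
      rw [S.wdist_comm w v] at h2
      rw [S.wdist_comm w z]
      omega
    · right
      have h1 := S.wdist_triangle x v (p i)
      have h2 := S.wdist_triangle w v (p i)
      rw [S.wdist_comm v (p i)] at h1 h2
      rw [S.wdist_comm w v] at h2
      rw [S.wdist_comm w x]
      omega
  classical
  -- Take the first point of the side that is near the side `wz`. Its predecessor is near `wx`; the
  -- step between them accounts for the summand 2 in the constant.
  have hex : ∃ i, i ≤ l ∧ S.wdist z (p i) + S.wdist w (p i) ≤ S.wdist w z + 2 * δ := by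
    refine ⟨l, le_rfl, ?_⟩
    rw [hl, S.wdist_self]; omega
  obtain ⟨hi, hzi⟩ := Nat.find_spec hex
  set i := Nat.find hex with hidef
  refine ⟨p i, by have := hbtw i hi; omega, ?_⟩
  have hb := hbtw i hi
  rw [S.wdist_comm z (p i)] at hzi
  rcases Nat.eq_zero_or_pos i with h | h
  · have hpi : p i = x := by rw [h, h0]
    rw [hpi] at hzi ⊢
    omega
  · have hmin := Nat.find_min hex (m := i - 1) (by omega)
    have hb' := hbtw (i - 1) (by omega)
    rcases hnear (i - 1) (by omega) with h' | h'
    · exact absurd ⟨by omega, h'⟩ hmin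
    · have h1 := hp (i - 1) i (by omega) hi
      have h2 := S.wdist_triangle w (p (i - 1)) (p i)
      omega

/-- Slim triangles imply the four-point inequality. -/
theorem IsSlim.fourPoint {δ : ℕ} (hS : S.IsSlim δ) : S.FourPoint (6 * δ + 2) := by
  intro w x y z
  obtain ⟨u, hu, hwu⟩ := hS.exists_near_geodesic w x z
  rcases hS.exists_close hu y with ⟨v, hv, huv⟩ | ⟨v, hv, huv⟩
  · right
    have h1 := S.wdist_triangle w u v
    have h2 := S.wdist_triangle w v z
    have h3 := S.wdist_triangle w v y
    rw [S.wdist_comm v z] at h2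
    rw [S.wdist_comm y z]
    omega
  · left
    have h1 := S.wdist_triangle w u v
    have h2 := S.wdist_triangle w v x
    have h3 := S.wdist_triangle w v y
    rw [S.wdist_comm v x] at h2
    omega

/-- A point that is nearly between the endpoints of a geodesic path is close to the path. -/
theorem FourPoint.exists_near_path {E : ℕ} (hE : S.FourPoint E) {p : ℕ → Γ} {l e : ℕ}
    (hp : ∀ i j, i ≤ j → j ≤ l → S.wdist (p i) (p j) = j - i) {u : Γ}
    (hu : S.wdist u (p 0) + S.wdist u (p l) ≤ l + e) :
    ∃ m ≤ l, S.wdist u (p m) ≤ e + E := by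
  rcases Nat.lt_or_ge l (S.wdist u (p 0)) with h | h
  · exact ⟨l, le_rfl, by omega⟩
  · refine ⟨S.wdist u (p 0), h, ?_⟩
    -- Compare `u` with the point of the path at the same distance from `p 0`; either alternative of
    -- the four-point inequality gives the bound.
    set m := S.wdist u (p 0) with hm
    have h1 := hp 0 m (Nat.zero_le _) h
    have h2 := hp m l h le_rfl
    have h3 := hp 0 l (Nat.zero_le _) le_rfl
    have h4 := hE u (p 0) (p m) (p l)
    omega

end FiniteGeneratingSet
end ExpHyp
-- Stability of quasigeodesics.
namespace ExpHyp
namespace FiniteGeneratingSet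

variable {Γ : Type*} [Group Γ] {S : FiniteGeneratingSet Γ}

variable (S) in
/-- Quasigeodesic sequences with integral constants. -/
structure IsQuasigeodesicSeq (A B C : ℕ) (q : ℕ → Γ) : Prop where
  step : ∀ i, S.wdist (q i) (q (i + 1)) ≤ B
  lower : ∀ i j, i ≤ j → j - i ≤ A * S.wdist (q i) (q j) + C

theorem IsQuasigeodesicSeq.upper {A B C : ℕ} {q : ℕ → Γ} (hq : S.IsQuasigeodesicSeq A B C q)
    {i j : ℕ} (hij : i ≤ j) : S.wdist (q i) (q j) ≤ B * (j - i) := by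
  induction j, hij using Nat.le_induction with
  | base => simp [S.wdist_self]
  | succ j hij ih =>
    have h1 := S.wdist_triangle (q i) (q j) (q (j + 1))
    have h2 := hq.step j
    rw [Nat.succ_sub hij, Nat.mul_succ]
    omega

/-- A point nearly between two points of a path is close to the path, up to a logarithm of the
length of the path. -/
theorem FourPoint.exists_near_of_steps {E : ℕ} (hE : S.FourPoint E) {B : ℕ} {q : ℕ → Γ}
    (hq : ∀ i, S.wdist (q i) (q (i + 1)) ≤ B) (u : Γ) (k : ℕ) :
    ∀ i j e : ℕ, i ≤ j → j ≤ i + 2 ^ k →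
      S.wdist u (q i) + S.wdist u (q j) ≤ S.wdist (q i) (q j) + e →
      ∃ m, i ≤ m ∧ m ≤ j ∧ 2 * S.wdist u (q m) ≤ e + k * E + B := by
  induction k with
  | zero =>
    intro i j e hij hj hu
    have hB : S.wdist (q i) (q j) ≤ B := by
      rw [pow_zero] at hj
      obtain rfl | rfl : j = i ∨ j = i + 1 := by omega
      · simp [S.wdist_self]
      · exact hq i
    rcases le_total (S.wdist u (q i)) (S.wdist u (q j)) with h | h
    · exact ⟨i, le_rfl, hij, by omega⟩
    · exact ⟨j, hij, le_rfl, by omega⟩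
  | succ k ih =>
    intro i j e hij hj hu
    rw [pow_succ] at hj
    rw [add_mul, one_mul]
    have hpos : 0 < 2 ^ k := by positivity
    have him : i ≤ min (i + 2 ^ k) j := by omega
    have hmj : min (i + 2 ^ k) j ≤ j := by omega
    -- Bisection: the four-point inequality shows that `u` is still nearly between the endpoints of
    -- one of the two halves, with the error increased by `E`.
    set m := min (i + 2 ^ k) j with hm
    rcases hE u (q i) (q m) (q j) with h | h
    · obtain ⟨t, h1, h2, h3⟩ := ih i m (e + E) him (by omega) (by omega)
      exact ⟨t, h1, by omega, by omega⟩
    · obtain ⟨t, h1, h2, h3⟩ := ih m j (e + E) hmj (by omega) (by omega)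
      exact ⟨t, by omega, h2, by omega⟩

/-- At the threshold a square below the power of two dominates the linear function; afterwards
doubling absorbs each increment `a`, so `a ≤ 2 ^ m` is carried through the induction. -/
theorem exists_forall_linear_le_two_pow (a b : ℕ) : ∃ m₀, ∀ m ≥ m₀, a * m + b ≤ 2 ^ m := by
  refine ⟨2 * (2 * a + b), fun m hm => ?_⟩
  have hstart : a * (2 * (2 * a + b)) + b ≤ 2 ^ (2 * (2 * a + b)) ∧
      a ≤ 2 ^ (2 * (2 * a + b)) := by
    have h := (Nat.lt_two_pow_self (n := 2 * a + b))
    have h2 : (2 * a + b + 1) * (2 * a + b + 1) ≤ 2 ^ (2 * (2 * a + b)) := by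
      rw [two_mul (2 * a + b), pow_add]
      exact Nat.mul_le_mul h h
    constructor <;> nlinarith
  suffices h : a * m + b ≤ 2 ^ m ∧ a ≤ 2 ^ m from h.1
  induction m, hm using Nat.le_induction with
  | base => exact hstart
  | succ m _ ih =>
    rw [pow_succ, mul_add, mul_one]
    omega

/-- The hypothesis bounds `D` by a multiple of `log D` plus a constant, hence bounds `D`. For large
`D` the exponent `k = D / (E + 1)` is admissible, and `k * E ≤ D` then forces `D ≤ 2 * E + B`. -/
theorem exists_bound_of_log_le (a b E B : ℕ) :
    ∃ D₀ : ℕ, ∀ D : ℕ, (∀ k : ℕ, a * D + b ≤ 2 ^ k → 2 * D ≤ 2 * E + k * E + B) → D ≤ D₀ := by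
  have hpos : 0 < E + 1 := Nat.succ_pos E
  obtain ⟨m₀, hm₀⟩ := exists_forall_linear_le_two_pow (a * (E + 1)) (a * (E + 1) + b)
  refine ⟨(E + 1) * m₀ + (2 * E + B), fun D hD => ?_⟩
  by_contra! hlt
  have h1 : D < (E + 1) * (D / (E + 1) + 1) := Nat.lt_mul_div_succ D hpos
  have h2 : D / (E + 1) * (E + 1) ≤ D := Nat.div_mul_le_self D (E + 1)
  have h3 : m₀ ≤ D / (E + 1) := by
    rw [Nat.le_div_iff_mul_le hpos, mul_comm]
    omega
  set m := D / (E + 1)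
  have h4 : a * D + b ≤ 2 ^ m := by
    refine le_trans ?_ (hm₀ m h3)
    have := Nat.mul_le_mul_left a h1.le
    nlinarith
  have h5 := hD m h4
  rw [mul_add, mul_one] at h2
  omega

/-- Geodesics stay close to quasigeodesics with the same endpoints. -/
theorem FourPoint.exists_near_quasigeodesic {E : ℕ} (hE : S.FourPoint E) (A B C : ℕ) :
    ∃ D₀ : ℕ, ∀ (q p : ℕ → Γ) (n l : ℕ), S.IsQuasigeodesicSeq A B C q →
      S.IsGeodesicSegment p l (q 0) (q n) → ∀ t ≤ l, ∃ i ≤ n, S.wdist (p t) (q i) ≤ D₀ := by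
  obtain ⟨D₀, hD₀⟩ := exists_bound_of_log_le (A * 6) C E B
  refine ⟨D₀ + E, ?_⟩
  rintro q p n l hq ⟨hp0, hpl, hp⟩
  classical
  -- Let `D` be the least radius for which the geodesic lies in the `D`-neighborhood of the
  -- quasigeodesic, and `u` a point of the geodesic where this is sharp.
  have hex : ∃ D, ∀ t ≤ l, ∃ i ≤ n, S.wdist (p t) (q i) ≤ D := by
    refine ⟨l, fun t ht => ⟨0, Nat.zero_le n, ?_⟩⟩
    rw [← hp0, S.wdist_comm, hp 0 t (Nat.zero_le t) ht]
    omega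
  have hfind := Nat.find_spec hex
  have hmin := fun {m} => Nat.find_min hex (m := m)
  set D := Nat.find hex
  suffices hD : D ≤ D₀ + E from fun t ht => by
    obtain ⟨i, hi, h⟩ := hfind t ht
    exact ⟨i, hi, h.trans hD⟩
  rcases Nat.eq_zero_or_pos D with h0 | hpos
  · omega
  have hfar := hmin (m := D - 1) (by omega)
  push Not at hfar
  obtain ⟨t, ht, hfar⟩ := hfar
  set u := p t with hu
  replace hfar : ∀ i ≤ n, D ≤ S.wdist u (q i) := fun i hi => by have := hfar i hi; omega
  -- Go back `2 * D` along the geodesic and cross to the quasigeodesic, or stop at the common start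
  -- if it comes earlier. The last inequality says that, seen from `u`, the two points have Gromov
  -- product at least `D`.
  obtain ⟨i, hi, hai, hai'⟩ : ∃ i ≤ n, S.wdist (p (t - 2 * D)) (q i) ≤ D ∧
      S.wdist (p (t - 2 * D)) (q i) + 2 * D ≤
        S.wdist u (p (t - 2 * D)) + S.wdist u (q i) := by
    rcases Nat.lt_or_ge t (2 * D) with h | h
    · refine ⟨0, Nat.zero_le n, ?_⟩
      have := hfar 0 (Nat.zero_le n)
      rw [show t - 2 * D = 0 by omega, hp0, S.wdist_self]
      omega
    · obtain ⟨i, hi, h'⟩ := hfind (t - 2 * D) (by omega)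
      have h1 := hfar i hi
      have h2 := hp (t - 2 * D) t (by omega) ht
      rw [S.wdist_comm, ← hu] at h2
      exact ⟨i, hi, h', by omega⟩
  obtain ⟨j, hj, hbj, hbj'⟩ : ∃ j ≤ n, S.wdist (p (min l (t + 2 * D))) (q j) ≤ D ∧
      S.wdist (p (min l (t + 2 * D))) (q j) + 2 * D ≤
        S.wdist u (p (min l (t + 2 * D))) + S.wdist u (q j) := by
    rcases Nat.lt_or_ge l (t + 2 * D) with h | h
    · refine ⟨n, le_rfl, ?_⟩
      have := hfar n le_rfl
      rw [min_eq_left h.le, hpl, S.wdist_self]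
      omega
    · rw [min_eq_right h]
      obtain ⟨j, hj, h'⟩ := hfind (t + 2 * D) h
      have h1 := hfar j hj
      have h2 := hp t (t + 2 * D) (by omega) h
      rw [← hu] at h2
      exact ⟨j, hj, h', by omega⟩
  have hua := hp (t - 2 * D) t (by omega) ht
  have hub := hp t (min l (t + 2 * D)) (by omega) (by omega)
  have hab := hp (t - 2 * D) (min l (t + 2 * D)) (by omega) (by omega)
  rw [S.wdist_comm, ← hu] at hua
  rw [← hu] at hub
  set x := p (t - 2 * D)
  set y := p (min l (t + 2 * D))
  rcases Nat.lt_or_ge E D with hED | hED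
  swap
  · omega
  -- Seen from `u`, the points `x` and `y` have product 0, whereas `x`, `q i` and `y`, `q j` have
  -- product at least `D > E`. So `q i` and `q j` lie in nearly opposite directions.
  have hij : S.wdist u (q i) + S.wdist u (q j) ≤ S.wdist (q i) (q j) + 2 * E := by
    have h1 := hE u x (q i) y
    have h2 := hE u (q i) (q j) y
    rw [S.wdist_comm (q j) y] at h2
    omega
  have hdij : S.wdist (q i) (q j) ≤ 6 * D := by
    have h1 := S.wdist_triangle (q i) x (q j)
    have h2 := S.wdist_triangle x y (q j)
    rw [S.wdist_comm (q i) x] at h1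
    omega
  -- The quasigeodesic from `q i` to `q j` has a number of steps linear in `D`, so it passes
  -- logarithmically close to `u`; yet all its points are at distance at least `D`.
  refine (hD₀ D fun k hk => ?_).trans (Nat.le_add_right _ _)
  have hAD : A * S.wdist (q i) (q j) ≤ A * 6 * D := by
    rw [mul_assoc]; exact Nat.mul_le_mul_left A hdij
  rcases le_total i j with h | h
  · have h1 := hq.lower i j h
    obtain ⟨m, -, hm, h2⟩ :=
      hE.exists_near_of_steps hq.step u k i j (2 * E) h (by omega) hij
    have := hfar m (by omega)
    omega
  · have h1 := hq.lower j i h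
    rw [S.wdist_comm] at h1
    obtain ⟨m, -, hm, h2⟩ :=
      hE.exists_near_of_steps hq.step u k j i (2 * E) h (by omega)
        (by rw [S.wdist_comm (q j)]; omega)
    have := hfar m (by omega)
    omega

/-- Stability of quasigeodesics: a quasigeodesic is close to any geodesic with the same
endpoints. -/
theorem FourPoint.exists_hausdorff_quasigeodesic {E : ℕ} (hE : S.FourPoint E) (A B C : ℕ) :
    ∃ R : ℕ, ∀ (q p : ℕ → Γ) (n l : ℕ), S.IsQuasigeodesicSeq A B C q →
      S.IsGeodesicSegment p l (q 0) (q n) →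
      (∀ t ≤ l, ∃ i ≤ n, S.wdist (p t) (q i) ≤ R) ∧
        ∀ i ≤ n, ∃ t ≤ l, S.wdist (q i) (p t) ≤ R := by
  obtain ⟨D, hD⟩ := hE.exists_near_quasigeodesic A B C
  refine ⟨D + B * (A * (2 * D + 1) + C), fun q p n l hq hpq => ⟨fun t ht => ?_, fun i hi => ?_⟩⟩
  · obtain ⟨i, hi, h⟩ := hD q p n l hq hpq t ht
    exact ⟨i, hi, by omega⟩
  have hnear := hD q p n l hq hpq
  obtain ⟨hp0, hpl, hp⟩ := hpq
  -- If the quasigeodesic is at two close points before and after time `i`, little time has passed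
  -- between them, so `q i` is close to both.
  have key : ∀ t j j', j ≤ i → i ≤ j' → S.wdist (p t) (q j) ≤ D →
      S.wdist (q j) (q j') ≤ 2 * D + 1 →
      S.wdist (q i) (p t) ≤ D + B * (A * (2 * D + 1) + C) := by
    intro t j j' hj hj' h1 h2
    have h3 := hq.lower j j' (hj.trans hj')
    have h4 := Nat.mul_le_mul_left A h2
    have h5 := (hq.upper hj).trans
      (Nat.mul_le_mul_left B (show i - j ≤ A * (2 * D + 1) + C by omega))
    have h6 := S.wdist_triangle (p t) (q j) (q i)
    rw [S.wdist_comm]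
    omega
  by_cases hl : ∃ j ≤ i, S.wdist (p l) (q j) ≤ D
  · obtain ⟨j, hj, h⟩ := hl
    refine ⟨l, le_rfl, key l j n hj hi h ?_⟩
    rw [hpl, S.wdist_comm] at h
    omega
  · classical
    -- At the first time when the geodesic is no longer near `q 0, …, q i` it is near some later `q
    -- j'`, while one step earlier it was near some `q j` with `j ≤ i`.
    have hex : ∃ t, t ≤ l ∧ ¬ ∃ j ≤ i, S.wdist (p t) (q j) ≤ D := ⟨l, le_rfl, hl⟩
    obtain ⟨htl, ht⟩ := Nat.find_spec hex
    have hmin := fun {m} => Nat.find_min hex (m := m)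
    set t := Nat.find hex
    rcases Nat.eq_zero_or_pos t with h0 | hpos
    · refine absurd ⟨0, Nat.zero_le i, ?_⟩ ht
      rw [h0, hp0, S.wdist_self]
      exact Nat.zero_le D
    · have h1 := hmin (m := t - 1) (by omega)
      have htl' : t - 1 ≤ l := by omega
      simp only [htl', true_and, not_not] at h1
      obtain ⟨j, hj, h1⟩ := h1
      obtain ⟨j', hj', h2⟩ := hnear t htl
      have hij' : i ≤ j' := by
        by_contra! h
        exact ht ⟨j', h.le, h2⟩
      refine ⟨t - 1, htl', key (t - 1) j j' hj hij' h1 ?_⟩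
      have h3 := hp (t - 1) t (by omega) htl
      have h4 := S.wdist_triangle (q j) (p (t - 1)) (q j')
      have h5 := S.wdist_triangle (p (t - 1)) (p t) (q j')
      rw [S.wdist_comm (q j) (p (t - 1))] at h4
      omega

/-- Every quasigeodesic ray is close to a geodesic ray with the same origin. -/
theorem FourPoint.exists_geodesicRay {E : ℕ} (hE : S.FourPoint E) (A B C : ℕ) :
    ∃ R : ℕ, ∀ q : ℕ → Γ, S.IsQuasigeodesicSeq A B C q →
      ∃ r : S.GeodesicRay, r.1 0 = q 0 ∧ S.HausdorffClose R (range q) (range r.1) := by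
  obtain ⟨R, hR⟩ := hE.exists_hausdorff_quasigeodesic A B C
  refine ⟨R, fun q hq => ?_⟩
  choose p hp using fun n => S.exists_isGeodesicSegment (q 0) (q n)
  have hlong : ∀ t : ℕ, ∀ᶠ n in (hyperfilter ℕ : Filter ℕ), t ≤ S.wdist (q 0) (q n) := by
    intro t
    have : ∀ᶠ n in atTop, t ≤ S.wdist (q 0) (q n) := by
      filter_upwards [eventually_gt_atTop (A * t + C)] with n hn
      by_contra! h
      have h1 := hq.lower 0 n (Nat.zero_le n)
      have h2 := Nat.mul_le_mul_left A h.le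
      omega
    exact Nat.hyperfilter_le_atTop this
  -- Balls are finite, so the segments from `q 0` to `q n` converge pointwise along a nonprincipal
  -- ultrafilter; this replaces a diagonal argument.
  have hlim : ∀ t : ℕ, ∃ g, ∀ᶠ n in (hyperfilter ℕ : Filter ℕ), p n t = g := by
    intro t
    have h : ∀ᶠ n in (hyperfilter ℕ : Filter ℕ), ∃ g ∈ {g | S.wdist (q 0) g ≤ t}, p n t = g := by
      filter_upwards [hlong t] with n hn
      refine ⟨p n t, ?_, rfl⟩
      have := (hp n).2.2 0 t (Nat.zero_le t) hn
      rw [(hp n).1] at this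
      exact this.le
    rw [Ultrafilter.eventually_exists_mem_iff (S.finite_closedBall (q 0) t)] at h
    obtain ⟨g, -, hg⟩ := h
    exact ⟨g, hg⟩
  choose r hr using hlim
  have hgeo : ∀ i j, i ≤ j → S.wdist (r i) (r j) = j - i := by
    intro i j hij
    obtain ⟨n, hi, hj, hn⟩ := ((hr i).and ((hr j).and (hlong j))).exists
    rw [← hi, ← hj]
    exact (hp n).2.2 i j hij hn
  refine ⟨⟨r, hgeo⟩, ?_, ?_, ?_⟩
  · obtain ⟨n, hn⟩ := (hr 0).exists
    exact hn.symm.trans (hp n).1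
  · rintro _ ⟨i, rfl⟩
    -- A point of the segment within `R` of `q i` has parameter at most `d(q 0, q i) + R`, so
    -- agreement with the limit is needed at finitely many times only.
    have hall : ∀ᶠ n in (hyperfilter ℕ : Filter ℕ),
        ∀ t ∈ Finset.range (S.wdist (q 0) (q i) + R + 1), p n t = r t :=
      (Filter.eventually_all_finset _).2 fun t _ => hr t
    have hi : ∀ᶠ n in (hyperfilter ℕ : Filter ℕ), i ≤ n :=
      Nat.hyperfilter_le_atTop (eventually_ge_atTop i)
    obtain ⟨n, hn, hin⟩ := (hall.and hi).exists
    obtain ⟨t, ht, h⟩ := (hR q (p n) n _ hq (hp n)).2 i hin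
    refine ⟨r t, ⟨t, rfl⟩, ?_⟩
    rw [← hn t ?_]
    · exact h
    · have h1 := (hp n).2.2 0 t (Nat.zero_le t) ht
      rw [(hp n).1] at h1
      have h2 := S.wdist_triangle (q 0) (q i) (p n t)
      rw [Finset.mem_range]
      omega
  · rintro _ ⟨t, rfl⟩
    obtain ⟨n, hn, hl⟩ := ((hr t).and (hlong t)).exists
    obtain ⟨i, -, h⟩ := (hR q (p n) n _ hq (hp n)).1 t hl
    exact ⟨q i, ⟨i, rfl⟩, by rwa [hn] at h⟩

end FiniteGeneratingSet
end ExpHyp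
-- Gromov products and contraction on the boundary.
namespace ExpHyp
namespace FiniteGeneratingSet

variable {Γ : Type*} [Group Γ] {S : FiniteGeneratingSet Γ}

theorem le_wdist_ray (a : S.GeodesicRay) (g : Γ) (s : ℕ) :
    s ≤ S.wdist g (a.1 s) + S.wdist g (a.1 0) := by
  have h1 := a.2 0 s (Nat.zero_le s)
  have h2 := S.wdist_triangle (a.1 0) g (a.1 s)
  rw [S.wdist_comm (a.1 0) g] at h2
  omega

/-- The Gromov products of points on two asymptotic rays tend to infinity. -/
theorem HausdorffClose.exists_product_ge {N : ℕ} {a b : S.GeodesicRay}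
    (h : S.HausdorffClose N (range a.1) (range b.1)) (g : Γ) (n : ℕ) :
    ∃ T, ∀ s ≥ T, ∀ t ≥ T,
      S.wdist (a.1 s) (b.1 t) + n ≤ S.wdist g (a.1 s) + S.wdist g (b.1 t) := by
  refine ⟨n + 2 * N + 2 * S.wdist g (a.1 0) + S.wdist (a.1 0) (b.1 0), fun s hs t ht => ?_⟩
  obtain ⟨_, ⟨m, rfl⟩, hm⟩ := h.2 _ ⟨t, rfl⟩
  have h1 := le_wdist_ray a g s
  have h2 := le_wdist_ray a g m
  have h3 := le_wdist_ray b (a.1 0) t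
  have h4 := S.wdist_triangle (a.1 s) (a.1 m) (b.1 t)
  have h5 := S.wdist_triangle g (b.1 t) (a.1 m)
  have h6 := S.wdist_triangle (a.1 0) (a.1 m) (b.1 t)
  rw [a.2 0 m (Nat.zero_le m)] at h6
  rw [S.wdist_comm (b.1 t)] at hm h5
  rcases le_total s m with hsm | hsm
  · rw [a.2 s m hsm] at h4
    omega
  · rw [S.wdist_comm (a.1 s) (a.1 m), a.2 m s hsm] at h4
    omega

/-- When the product of `a s` and `b t` is at least `k`, the point `a k` is nearly between `a 0` and
`b t`. Replacing the origin `a 0` by `b 0` only adds to the error, and `FourPoint.exists_near_path`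
applies. -/
theorem FourPoint.exists_near_ray_of_product {E : ℕ} (hE : S.FourPoint E) (a b : S.GeodesicRay)
    (h : ∀ n, ∃ s t,
      S.wdist (a.1 s) (b.1 t) + n ≤ S.wdist (a.1 0) (a.1 s) + S.wdist (a.1 0) (b.1 t)) (k : ℕ) :
    ∃ m, S.wdist (a.1 k) (b.1 m) ≤ 2 * S.wdist (a.1 0) (b.1 0) + 2 * E := by
  obtain ⟨s, t, hst⟩ := h (2 * k)
  have hs : k ≤ s := by
    have h1 := S.wdist_triangle (a.1 0) (a.1 s) (b.1 t)
    have h2 := a.2 0 s (Nat.zero_le s)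
    omega
  have h1 := a.2 0 s (Nat.zero_le s)
  have h2 := a.2 0 k (Nat.zero_le k)
  have h3 := a.2 k s hs
  have h4 := hE (a.1 0) (a.1 k) (a.1 s) (b.1 t)
  have h5 := b.2 0 t (Nat.zero_le t)
  have h6 := S.wdist_triangle (a.1 0) (b.1 0) (b.1 t)
  have h7 := S.wdist_triangle (a.1 k) (a.1 0) (b.1 0)
  rw [S.wdist_comm (a.1 k) (a.1 0)] at h7
  obtain ⟨m, -, hm⟩ := hE.exists_near_path (l := t) (e := 2 * S.wdist (a.1 0) (b.1 0) + E)
    (fun i j hij _ => b.2 i j hij) (u := a.1 k) (by omega)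
  exact ⟨m, by omega⟩

/-- Asymptotic rays are uniformly close, in terms of the distance of their origins. -/
theorem FourPoint.hausdorffClose_of_asymptotic {E : ℕ} (hE : S.FourPoint E) {N : ℕ}
    {a b : S.GeodesicRay} (h : S.HausdorffClose N (range a.1) (range b.1)) :
    S.HausdorffClose (2 * S.wdist (a.1 0) (b.1 0) + 2 * E) (range a.1) (range b.1) := by
  have key : ∀ (a b : S.GeodesicRay), S.HausdorffClose N (range a.1) (range b.1) →
      ∀ x ∈ range a.1, ∃ y ∈ range b.1, S.wdist x y ≤ 2 * S.wdist (a.1 0) (b.1 0) + 2 * E := by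
    rintro a b h _ ⟨k, rfl⟩
    obtain ⟨m, hm⟩ := hE.exists_near_ray_of_product a b (fun n => by
      obtain ⟨T, hT⟩ := h.exists_product_ge (a.1 0) n
      exact ⟨T, T, hT T le_rfl T le_rfl⟩) k
    exact ⟨_, ⟨m, rfl⟩, hm⟩
  refine ⟨key a b h, ?_⟩
  rw [S.wdist_comm (a.1 0)]
  exact key b a h.symm

/-- The Gromov product of two boundary points, based at the identity, is at least `n / 2`. -/
def ProductGE (n : ℕ) (ζ ζ' : S.Boundary) : Prop :=
  ∀ a a' : S.GeodesicRay, S.endpoint a = ζ → S.endpoint a' = ζ' → ∃ T, ∀ s ≥ T, ∀ t ≥ T,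
    S.wdist (a.1 s) (a'.1 t) + n ≤ S.wdist 1 (a.1 s) + S.wdist 1 (a'.1 t)

theorem endpoint_eq_iff {a b : S.GeodesicRay} :
    S.endpoint a = S.endpoint b ↔ ∃ N : ℕ, S.HausdorffClose N (range a.1) (range b.1) :=
  Quotient.eq (r := S.asymptoticSetoid)

theorem exists_endpoint_eq (ζ : S.Boundary) : ∃ a, S.endpoint a = ζ := Quotient.exists_rep ζ

/-- Lets `ProductGE` be checked on one pair of representatives at arbitrarily late times. Points of
asymptotic rays have large products, so two uses of the four-point inequality carry the bound to all
other representatives and late times, each costing `E`. -/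
theorem FourPoint.productGE_of_frequently {E : ℕ} (hE : S.FourPoint E) {n : ℕ}
    {a a' : S.GeodesicRay} (h : ∀ T, ∃ s ≥ T, ∃ t ≥ T,
      S.wdist (a.1 s) (a'.1 t) + (n + 2 * E) ≤ S.wdist 1 (a.1 s) + S.wdist 1 (a'.1 t)) :
    ProductGE n (S.endpoint a) (S.endpoint a') := by
  intro b b' hb hb'
  obtain ⟨N, hN⟩ := endpoint_eq_iff.1 hb
  obtain ⟨N', hN'⟩ := endpoint_eq_iff.1 hb'.symm
  obtain ⟨T, hT⟩ := hN.exists_product_ge 1 (n + 2 * E)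
  obtain ⟨T', hT'⟩ := hN'.exists_product_ge 1 (n + 2 * E)
  obtain ⟨s₀, hs₀, t₀, ht₀, h₀⟩ := h (max T T')
  refine ⟨max T T', fun s hs t ht => ?_⟩
  have h1 := hT s (by omega) s₀ (by omega)
  have h2 := hT' t₀ (by omega) t (by omega)
  have h3 := hE 1 (b.1 s) (a.1 s₀) (b'.1 t)
  have h4 := hE 1 (a.1 s₀) (a'.1 t₀) (b'.1 t)
  omega

theorem ProductGE.symm {n : ℕ} {ζ ζ' : S.Boundary} (h : ProductGE n ζ ζ') :
    ProductGE n ζ' ζ := by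
  intro a a' ha ha'
  obtain ⟨T, hT⟩ := h a' a ha' ha
  refine ⟨T, fun s hs t ht => ?_⟩
  have := hT t ht s hs
  rw [S.wdist_comm]
  omega

theorem ProductGE.trans {E : ℕ} (hE : S.FourPoint E) {n : ℕ} {ζ ζ' ζ'' : S.Boundary}
    (h : ProductGE (n + E) ζ ζ') (h' : ProductGE (n + E) ζ' ζ'') : ProductGE n ζ ζ'' := by
  intro a a'' ha ha''
  obtain ⟨a', ha'⟩ := exists_endpoint_eq ζ'
  obtain ⟨T, hT⟩ := h a a' ha ha'
  obtain ⟨T', hT'⟩ := h' a' a'' ha' ha''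
  refine ⟨max T T', fun s hs t ht => ?_⟩
  have h1 := hT s (by omega) (max T T') (by omega)
  have h2 := hT' (max T T') (by omega) t (by omega)
  have h3 := hE 1 (a.1 s) (a'.1 (max T T')) (a''.1 t)
  omega

theorem FourPoint.eq_of_forall_productGE {E : ℕ} (hE : S.FourPoint E) {ζ ζ' : S.Boundary}
    (h : ∀ n, ProductGE n ζ ζ') : ζ = ζ' := by
  obtain ⟨a, rfl⟩ := exists_endpoint_eq ζ
  obtain ⟨a', rfl⟩ := exists_endpoint_eq ζ'
  have key : ∀ a b : S.GeodesicRay, (∀ n, ProductGE n (S.endpoint a) (S.endpoint b)) →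
      ∀ x ∈ range a.1, ∃ y ∈ range b.1, S.wdist x y ≤ 2 * S.wdist (a.1 0) (b.1 0) + 2 * E := by
    rintro a b h _ ⟨k, rfl⟩
    obtain ⟨m, hm⟩ := hE.exists_near_ray_of_product a b (fun n => by
      obtain ⟨T, hT⟩ := h (n + 2 * S.wdist 1 (a.1 0)) a b rfl rfl
      refine ⟨T, T, ?_⟩
      have h1 := hT T le_rfl T le_rfl
      have h2 := S.wdist_triangle 1 (a.1 0) (a.1 T)
      have h3 := S.wdist_triangle 1 (a.1 0) (b.1 T)
      omega) k
    exact ⟨_, ⟨m, rfl⟩, hm⟩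
  refine endpoint_eq_iff.2 ⟨2 * S.wdist (a.1 0) (a'.1 0) + 2 * E, key a a' h, ?_⟩
  rw [S.wdist_comm (a.1 0)]
  exact key a' a fun n => (h n).symm

/-- Beyond time `n` the two rays separate by at most `k` plus twice the elapsed time, so doubled
products stay at least `2 * n - k`. -/
theorem FourPoint.productGE_of_mem_basicNhd {E : ℕ} (hE : S.FourPoint E) {k n m : ℕ}
    {ξ ζ : S.Boundary} (h : ζ ∈ S.basicNhd k n ξ) (hm : m + k + 2 * E ≤ 2 * n) :
    ProductGE m ξ ζ := by
  obtain ⟨c₀, c, h0, h1, rfl, rfl, hd⟩ := h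
  refine hE.productGE_of_frequently fun T =>
    ⟨max T n, le_max_left _ _, max T n, le_max_left _ _, ?_⟩
  have hn : n ≤ max T n := le_max_right _ _
  set s := max T n
  have h2 := c₀.2 0 s (Nat.zero_le s)
  have h3 := c.2 0 s (Nat.zero_le s)
  have h4 := c₀.2 n s hn
  have h5 := c.2 n s hn
  have h6 := S.wdist_triangle (c₀.1 s) (c₀.1 n) (c.1 s)
  have h7 := S.wdist_triangle (c₀.1 n) (c.1 n) (c.1 s)
  rw [S.wdist_comm (c₀.1 s) (c₀.1 n)] at h6
  rw [S.wdist_comm] at hd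
  rw [h0] at h2
  rw [h1] at h3
  omega

/-- The points whose Gromov product with a given point is large form a neighborhood. -/
theorem FourPoint.exists_isOpen_productGE {E : ℕ} (hE : S.FourPoint E) (n : ℕ)
    (ζ : S.Boundary) :
    ∃ V : Set S.Boundary, IsOpen V ∧ ζ ∈ V ∧ ∀ ζ' ∈ V, ProductGE n ζ ζ' := by
  -- Transitivity of `ProductGE` loses `E`, so openness of the product ball itself is not evident.
  -- Taken instead is the set of points around which some product ball lies in it.
  refine ⟨{ζ' | ∃ m, ∀ ζ'', ProductGE m ζ' ζ'' → ProductGE n ζ ζ''}, ?_, ⟨n, fun _ h => h⟩, ?_⟩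
  · rintro ζ' ⟨m, hm⟩ k
    filter_upwards [eventually_ge_atTop (m + E + k + 2 * E)] with j hj ζ'' hζ''
    refine ⟨m + E, fun η hη => hm η (ProductGE.trans hE ?_ hη)⟩
    exact hE.productGE_of_mem_basicNhd hζ'' (by omega)
  · rintro ζ' ⟨m, hm⟩
    obtain ⟨a, rfl⟩ := exists_endpoint_eq ζ'
    refine hm _ (hE.productGE_of_frequently fun T => ?_)
    obtain ⟨T', hT'⟩ := (HausdorffClose.refl S (range a.1)).exists_product_ge 1 (m + 2 * E)
    exact ⟨max T T', le_max_left _ _, max T T', le_max_left _ _,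
      hT' _ (le_max_right _ _) _ (le_max_right _ _)⟩

/-- Going backwards along a ray contracts a neighborhood of every boundary point that is different
from the endpoint of the ray. -/
theorem FourPoint.exists_isOpen_contracting {E : ℕ} (hE : S.FourPoint E) (R : ℕ)
    {r : S.GeodesicRay} {ζ : S.Boundary} (hζ : ζ ≠ S.endpoint r) :
    ∃ V : Set S.Boundary, IsOpen V ∧ ζ ∈ V ∧ ∀ N : ℕ, ∃ m₀ : ℕ, ∀ m ≥ m₀, ∀ g : Γ,
      S.wdist g (r.1 m) ≤ R →
        ∀ ζ' ∈ V, ∀ ζ'' ∈ V, ProductGE N (g⁻¹ • ζ') (g⁻¹ • ζ'') := by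
  obtain ⟨n, hn⟩ : ∃ n, ¬ ProductGE n ζ (S.endpoint r) := by
    by_contra! h
    exact hζ (hE.eq_of_forall_productGE h)
  obtain ⟨V, hVo, hζV, hV⟩ := hE.exists_isOpen_productGE (n + E) ζ
  refine ⟨V, hVo, hζV, fun N => ⟨N + 10 * E + n + 4 * R + 2 * S.wdist 1 (r.1 0),
    fun m hm g hg => ?_⟩⟩
  -- A ray ending in `V` has bounded product with `r`, hence with `g`, seen from the identity.
  -- Equivalently, seen from `g` it leaves in nearly the direction of the identity.
  have hdiv : ∀ a : S.GeodesicRay, S.endpoint a ∈ V → ∃ T, ∀ s ≥ T,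
      S.wdist 1 (a.1 s) + S.wdist 1 g < S.wdist g (a.1 s) + (n + 4 * E + 2 * R) := by
    intro a ha
    have hnot : ¬ ProductGE (n + E) (S.endpoint a) (S.endpoint r) :=
      fun h => hn (ProductGE.trans hE (hV _ ha) h)
    obtain ⟨T, hT⟩ := not_forall.1 (mt hE.productGE_of_frequently hnot)
    push Not at hT
    refine ⟨T, fun s hs => ?_⟩
    have h1 := hT s hs (max T m) (le_max_left _ _)
    have h2 := hE 1 (a.1 s) (r.1 m) (r.1 (max T m))
    have h3 := r.2 m (max T m) (le_max_right _ _)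
    have h4 := le_wdist_ray r 1 m
    have h5 := le_wdist_ray r 1 (max T m)
    have h6 := S.wdist_triangle (a.1 s) g (r.1 m)
    have h7 := S.wdist_triangle 1 (r.1 m) g
    rw [S.wdist_comm (a.1 s) g] at h6
    rw [S.wdist_comm (r.1 m) g] at h7
    omega
  rintro ζ' hζ' ζ'' hζ''
  obtain ⟨a, rfl⟩ := exists_endpoint_eq ζ'
  obtain ⟨b, rfl⟩ := exists_endpoint_eq ζ''
  obtain ⟨T, hT⟩ := hdiv a hζ'
  obtain ⟨T', hT'⟩ := hdiv b hζ''
  rw [S.smul_endpoint, S.smul_endpoint]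
  refine hE.productGE_of_frequently fun T₀ =>
    ⟨max T₀ (max T T'), le_max_left _ _, max T₀ (max T T'), le_max_left _ _, ?_⟩
  set s := max T₀ (max T T') with hs
  have h1 := hT s (by omega)
  have h2 := hT' s (by omega)
  -- Change the base point to `g`: both rays have product about `d(1, g)` with the identity, hence
  -- at least about that with each other, and `d(1, g)` grows with `m`.
  have h3 := hE g (a.1 s) 1 (b.1 s)
  have h4 := le_wdist_ray r 1 m
  have h5 := S.wdist_triangle 1 g (r.1 m)
  have htr : ∀ c : S.GeodesicRay,
      S.wdist 1 ((GeodesicRay.translate S g⁻¹ c).1 s) = S.wdist g (c.1 s) := by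
    intro c
    rw [← S.wdist_mul_left g]
    simp [GeodesicRay.translate]
  rw [htr, htr]
  change S.wdist (g⁻¹ * a.1 s) (g⁻¹ * b.1 s) + _ ≤ _
  rw [S.wdist_mul_left]
  rw [S.wdist_comm (a.1 s) 1, S.wdist_comm g 1] at h3
  omega

end FiniteGeneratingSet
end ExpHyp
-- Codes of an expanding action: uniform quasigeodesics and their endpoints.
namespace ExpHyp

theorem FiniteGeneratingSet.HausdorffClose.of_wdist_le {Γ : Type*} [Group Γ]
    {S T : FiniteGeneratingSet Γ} {K N : ℕ} (hK : ∀ g h, T.wdist g h ≤ K * S.wdist g h)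
    {X Y : Set Γ} (h : S.HausdorffClose N X Y) : T.HausdorffClose (K * N) X Y :=
  ⟨fun x hx => let ⟨y, hy, hxy⟩ := h.1 x hx
    ⟨y, hy, (hK x y).trans (Nat.mul_le_mul_left K hxy)⟩,
   fun y hy => let ⟨x, hx, hxy⟩ := h.2 y hy
    ⟨x, hx, (hK y x).trans (Nat.mul_le_mul_left K hxy)⟩⟩

theorem FiniteGeneratingSet.HausdorffClose.mono {Γ : Type*} [Group Γ]
    {S : FiniteGeneratingSet Γ} {N N' : ℕ} (hN : N ≤ N')
    {X Y : Set Γ} (h : S.HausdorffClose N X Y) : S.HausdorffClose N' X Y :=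
  ⟨fun x hx => let ⟨y, hy, hxy⟩ := h.1 x hx; ⟨y, hy, hxy.trans hN⟩,
   fun y hy => let ⟨x, hx, hxy⟩ := h.2 y hy; ⟨x, hx, hxy.trans hN⟩⟩

theorem FiniteGeneratingSet.IsQuasigeodesicSeq.isQuasigeodesicRay {Γ : Type*} [Group Γ]
    {S : FiniteGeneratingSet Γ} {A B C : ℕ} {q : ℕ → Γ} (hq : S.IsQuasigeodesicSeq A B C q) :
    S.IsQuasigeodesicRay q := by
  have key : ∀ i j : ℕ, i ≤ j →
      1 / ((A : ℝ) + B + 1) * |(i : ℝ) - j| - C ≤ S.wdist (q i) (q j) ∧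
        (S.wdist (q i) (q j) : ℝ) ≤ ((A : ℝ) + B + 1) * |(i : ℝ) - j| + C := by
    intro i j hij
    have h1 := hq.lower i j hij
    have h2 := hq.upper hij
    obtain ⟨k, rfl⟩ := Nat.exists_eq_add_of_le hij
    rw [Nat.add_sub_cancel_left] at h1 h2
    have h1' : (k : ℝ) ≤ A * S.wdist (q i) (q (i + k)) + C := by exact_mod_cast h1
    have h2' : (S.wdist (q i) (q (i + k)) : ℝ) ≤ B * k := by exact_mod_cast h2
    have habs : |(i : ℝ) - ((i + k : ℕ) : ℝ)| = k := by
      push_cast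
      rw [sub_add_cancel_left, abs_neg, abs_of_nonneg (Nat.cast_nonneg k)]
    rw [habs]
    have hA : (0 : ℝ) ≤ A := Nat.cast_nonneg A
    have hB : (0 : ℝ) ≤ B := Nat.cast_nonneg B
    have hC : (0 : ℝ) ≤ C := Nat.cast_nonneg C
    have hk : (0 : ℝ) ≤ k := Nat.cast_nonneg k
    have hd0 : (0 : ℝ) ≤ S.wdist (q i) (q (i + k)) := Nat.cast_nonneg _
    constructor
    · rw [sub_le_iff_le_add, one_div, inv_mul_le_iff₀ (by positivity)]
      nlinarith [mul_nonneg hB hd0, mul_nonneg hA hC, mul_nonneg hB hC]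
    · nlinarith [mul_nonneg hA hk]
  have hAB : (0 : ℝ) ≤ (A : ℝ) + B := by positivity
  refine ⟨(A : ℝ) + B + 1, C, by linarith, Nat.cast_nonneg C, fun i j => ?_⟩
  rcases le_total i j with h | h
  · exact key i j h
  · rw [S.wdist_comm, abs_sub_comm]
    exact key j i h

namespace ExpansionDatum

variable {Γ M : Type*} [Group Γ] [MetricSpace M] {ρ : Γ →* (M ≃ₜ M)} {Λ : Set M}
  (D : ExpansionDatum ρ Λ)

theorem L_pos : 0 < D.L := zero_lt_one.trans (D.one_lt_lam.trans_le D.lam_le_L)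

theorem lam_pos : 0 < D.lam := zero_lt_one.trans D.one_lt_lam

theorem orbit_succ_eq (α : ℕ → D.I) (x : M) (i : ℕ) :
    D.orbit α x (i + 1) = ρ (D.ray α i)⁻¹ x := by
  induction i with
  | zero => rfl
  | succ i ih =>
    change ρ (D.s (α (i + 1)))⁻¹ (D.orbit α x (i + 1)) = ρ (D.ray α i * D.s (α (i + 1)))⁻¹ x
    rw [ih, mul_inv_rev, map_mul]
    rfl

theorem apply_orbit_succ (α : ℕ → D.I) (x : M) (i k : ℕ) :
    ρ ((D.ray α (i + k))⁻¹ * D.ray α i) (D.orbit α x (i + 1)) = D.orbit α x (i + k + 1) := by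
  rw [orbit_succ_eq, orbit_succ_eq]
  change (ρ ((D.ray α (i + k))⁻¹ * D.ray α i) * ρ (D.ray α i)⁻¹) x = _
  rw [← map_mul, mul_inv_cancel_right]

theorem apply_mem (hinv : ∀ g, ρ g '' Λ = Λ) (g : Γ) {x : M} (hx : x ∈ Λ) : ρ g x ∈ Λ := by
  rw [← hinv g]; exact mem_image_of_mem _ hx

theorem orbit_mem (hinv : ∀ g, ρ g '' Λ = Λ) (α : ℕ → D.I) {x : M} (hx : x ∈ Λ) (i : ℕ) :
    D.orbit α x i ∈ Λ := by
  cases i with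
  | zero => exact hx
  | succ i => rw [orbit_succ_eq]; exact apply_mem hinv _ hx

theorem wdist_ray_succ_le (α : ℕ → D.I) (i : ℕ) :
    D.gens.wdist (D.ray α i) (D.ray α (i + 1)) ≤ 1 :=
  D.gens.wdist_mul_generator_le (mem_range_self (α (i + 1))) _

theorem wdist_one_ray_zero_le (α : ℕ → D.I) : D.gens.wdist 1 (D.ray α 0) ≤ 1 := by
  simpa [ray] using D.gens.wdist_mul_generator_le (mem_range_self (α 0)) 1

/-- Group elements act near `Λ` with Lipschitz constants exponential in the word length. -/
theorem eventually_dist_le (hinv : ∀ g, ρ g '' Λ = Λ) {g h : Γ}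
    (w : D.gens.cayleyGraph.Walk g h) {p : M} (hp : p ∈ Λ) :
    ∀ᶠ z in 𝓝 p, dist (ρ (h⁻¹ * g) z) (ρ (h⁻¹ * g) p) ≤ D.L ^ w.length * dist z p := by
  induction w generalizing p with
  | nil => simp
  | @cons g g' h hadj w ih =>
    -- An edge may be traversed in either direction; symmetry of the generating set puts both cases
    -- in the form to which the Lipschitz condition applies.
    obtain ⟨a, ha⟩ : ∃ a, g'⁻¹ * g = (D.s a)⁻¹ := by
      rw [FiniteGeneratingSet.cayleyGraph, SimpleGraph.mulCayley_adj'] at hadj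
      obtain ⟨-, _, ⟨b, rfl⟩, rfl | rfl⟩ := hadj
      · exact ⟨b, by group⟩
      · obtain ⟨a, ha⟩ := D.symmetric b
        exact ⟨a, by rw [ha]; group⟩
    have hsplit : ∀ z, ρ (h⁻¹ * g) z = ρ (h⁻¹ * g') (ρ (D.s a)⁻¹ z) := by
      intro z
      rw [← ha, show h⁻¹ * g = (h⁻¹ * g') * (g'⁻¹ * g) by group, map_mul]
      rfl
    have hp' : ρ (D.s a)⁻¹ p ∈ Λ := apply_mem hinv _ hp
    have hball : Metric.thickening D.δ Λ ∈ 𝓝 p :=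
      Metric.isOpen_thickening.mem_nhds (Metric.self_subset_thickening D.δ_pos Λ hp)
    filter_upwards [hball, (ρ (D.s a)⁻¹).continuous.continuousAt.eventually (ih hp')]
      with z hz hz'
    rw [hsplit, hsplit, SimpleGraph.Walk.length_cons, pow_succ, mul_assoc]
    refine hz'.trans (mul_le_mul_of_nonneg_left ?_ (pow_nonneg D.L_pos.le _))
    exact D.lipschitz a z hz p (Metric.self_subset_thickening D.δ_pos Λ hp)

variable {D}

/-- Going forward along a code expands small distances exponentially. -/
theorem IsCode.eventually_le_dist {η : ℝ} (hη : 0 < η) {x : M} {α : ℕ → D.I}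
    (hα : D.IsCode η x α) (i k : ℕ) :
    ∀ᶠ z in 𝓝 (D.orbit α x (i + 1)), D.lam ^ k * dist z (D.orbit α x (i + 1)) ≤
      dist (ρ ((D.ray α (i + k))⁻¹ * D.ray α i) z) (D.orbit α x (i + k + 1)) := by
  induction k with
  | zero => simp
  | succ k ih =>
    have hlim := D.apply_orbit_succ α x i k
    have hU : D.U (α (i + k + 1)) ∈ 𝓝 (D.orbit α x (i + k + 1)) :=
      mem_of_superset (Metric.ball_mem_nhds _ hη) (hα (i + k + 1) (by omega))
    have hcont := (ρ ((D.ray α (i + k))⁻¹ * D.ray α i)).continuous.continuousAt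
      (x := D.orbit α x (i + 1))
    rw [ContinuousAt, hlim] at hcont
    filter_upwards [ih, hcont.eventually hU] with z hz hzU
    have hexp := (D.expanding (α (i + k + 1))).1 _ hzU _ (mem_of_mem_nhds hU)
    have hstep : ρ ((D.ray α (i + (k + 1)))⁻¹ * D.ray α i) z =
        ρ (D.s (α (i + k + 1)))⁻¹ (ρ ((D.ray α (i + k))⁻¹ * D.ray α i) z) := by
      change ρ ((D.ray α (i + k) * D.s (α (i + k + 1)))⁻¹ * D.ray α i) z = _
      rw [mul_inv_rev, mul_assoc, map_mul]
      rfl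
    rw [hstep, pow_succ', mul_assoc]
    exact (mul_le_mul_of_nonneg_left hz D.lam_pos.le).trans hexp

/-- One group element obeys the lower bound `lam ^ k` from the code and the upper bound from a
shortest word for it. Both hold near the orbit point, and a nearby point different from it allows
division by the distance. -/
theorem IsCode.lam_pow_le (hinv : ∀ g, ρ g '' Λ = Λ)
    (hiso : ∀ x ∈ Λ, ¬ IsOpen ({x} : Set M)) {η : ℝ} (hη : 0 < η) {x : M} (hx : x ∈ Λ)
    {α : ℕ → D.I} (hα : D.IsCode η x α) (i k : ℕ) :
    D.lam ^ k ≤ D.L ^ D.gens.wdist (D.ray α i) (D.ray α (i + k)) := by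
  obtain ⟨w, hw⟩ := (D.gens.connected_cayleyGraph.preconnected (D.ray α i)
    (D.ray α (i + k))).exists_walk_length_eq_dist
  have hp := D.orbit_mem hinv α hx (i + 1)
  have hne : (𝓝[≠] (D.orbit α x (i + 1))).NeBot := by
    rw [neBot_iff, Ne, ← isOpen_singleton_iff_punctured_nhds]
    exact hiso _ hp
  have hself : ∀ᶠ z in 𝓝[≠] (D.orbit α x (i + 1)), z ≠ D.orbit α x (i + 1) :=
    self_mem_nhdsWithin
  obtain ⟨z, h1, h2, hz⟩ := (((hα.eventually_le_dist hη i k).filter_mono nhdsWithin_le_nhds).and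
    (((D.eventually_dist_le hinv w hp).filter_mono nhdsWithin_le_nhds).and
      hself)).exists
  have hlim := D.apply_orbit_succ α x i k
  rw [hlim, hw] at h2
  exact le_of_mul_le_mul_right (h1.trans h2) (dist_pos.2 hz)

variable (D) in
/-- All rays are uniform quasigeodesics. -/
theorem exists_isQuasigeodesicSeq (S : FiniteGeneratingSet Γ) (hinv : ∀ g, ρ g '' Λ = Λ)
    (hiso : ∀ x ∈ Λ, ¬ IsOpen ({x} : Set M)) :
    ∃ A B : ℕ, ∀ η, 0 < η → ∀ x ∈ Λ, ∀ α, D.IsCode η x α →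
      S.IsQuasigeodesicSeq A B 0 (D.ray α) := by
  obtain ⟨B, hB⟩ := S.exists_wdist_le_mul D.gens
  obtain ⟨K, hK⟩ := D.gens.exists_wdist_le_mul S
  -- With `L < lam ^ A`, comparing exponents of `lam` gives `k ≤ A * d`, the lower quasigeodesic
  -- bound.
  obtain ⟨A, hA⟩ := pow_unbounded_of_one_lt D.L D.one_lt_lam
  refine ⟨A * K, B, fun η hη x hx α hα => ⟨fun i => ?_, fun i j hij => ?_⟩⟩
  · refine (hB _ _).trans ?_
    simpa using Nat.mul_le_mul_left B (D.wdist_ray_succ_le α i)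
  · obtain ⟨k, rfl⟩ := Nat.exists_eq_add_of_le hij
    have h1 := hα.lam_pow_le hinv hiso hη hx i k
    have h2 : D.lam ^ k ≤ D.lam ^ (A * D.gens.wdist (D.ray α i) (D.ray α (i + k))) := by
      rw [pow_mul]
      exact h1.trans (pow_le_pow_left₀ D.L_pos.le hA.le _)
    have h3 := (pow_le_pow_iff_right₀ D.one_lt_lam).1 h2
    have h4 := Nat.mul_le_mul_left A (hK (D.ray α i) (D.ray α (i + k)))
    rw [Nat.add_sub_cancel_left, add_zero, mul_assoc]
    exact h3.trans h4

/-- Going backwards along a ray contracts balls exponentially. -/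
theorem IsCode.dist_ray_apply_lt (hinv : ∀ g, ρ g '' Λ = Λ) {η : ℝ} (hηδ : η ≤ D.δ) {x : M}
    (hx : x ∈ Λ) {α : ℕ → D.I} (hα : D.IsCode η x α) (i : ℕ) :
    ∀ κ ≤ η, ∀ z, dist z (D.orbit α x (i + 1)) < κ →
      dist (ρ (D.ray α i) z) x < D.L * κ / D.lam ^ i := by
  induction i with
  | zero =>
    intro κ hκ z hz
    -- The initial letter is arbitrary, so nothing contracts here; by symmetry `ρ (s (α 0))` is one
    -- of the `L`-Lipschitz maps, whence the factor `L`.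
    obtain ⟨b, hb⟩ := D.symmetric (α 0)
    have hp := D.orbit_mem hinv α hx 1
    have hz' : z ∈ Metric.thickening D.δ Λ :=
      Metric.mem_thickening_iff.2 ⟨_, hp, hz.trans_le (hκ.trans hηδ)⟩
    have h1 := D.lipschitz b z hz' _ (Metric.self_subset_thickening D.δ_pos Λ hp)
    rw [hb, inv_inv] at h1
    have h2 : ρ (D.s (α 0)) (D.orbit α x 1) = x := by
      change (ρ (D.s (α 0)) * ρ (D.s (α 0))⁻¹) x = x
      rw [← map_mul, mul_inv_cancel, map_one]
      rfl
    rw [h2] at h1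
    rw [pow_zero, div_one]
    exact h1.trans_lt (mul_lt_mul_of_pos_left hz D.L_pos)
  | succ i ih =>
    intro κ hκ z hz
    have hκ0 : 0 < κ := dist_nonneg.trans_lt hz
    have hle : κ / D.lam ≤ η := (div_le_self hκ0.le D.one_lt_lam.le).trans hκ
    have hball := (D.expanding (α (i + 1))).2 (D.orbit α x (i + 1)) (κ / D.lam)
      (hle.trans hηδ) ((Metric.ball_subset_ball hle).trans (hα (i + 1) (by omega)))
    rw [mul_div_cancel₀ _ D.lam_pos.ne'] at hball
    obtain ⟨y, hy, rfl⟩ := hball hz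
    have h1 := ih (κ / D.lam) hle y hy
    have h2 : ρ (D.ray α (i + 1)) (ρ (D.s (α (i + 1)))⁻¹ y) = ρ (D.ray α i) y := by
      change (ρ (D.ray α i * D.s (α (i + 1))) * ρ (D.s (α (i + 1)))⁻¹) y = _
      rw [← map_mul, mul_inv_cancel_right]
    rw [h2, pow_succ']
    calc _ < D.L * (κ / D.lam) / D.lam ^ i := h1
      _ = _ := by rw [← mul_div_assoc, div_div]

/-- A geodesic ray close to a ray of a code for `x` ends at `f x`. -/
theorem IsCode.eq_endpoint {S : FiniteGeneratingSet Γ} {E : ℕ} (hE : S.FourPoint E)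
    (hcomp : IsCompact Λ) (hinv : ∀ g, ρ g '' Λ = Λ) {f : Λ → S.Boundary}
    (hcont : Continuous f) (hequiv : ∀ (g : Γ) (x y : Λ), ρ g x = y → f y = g • f x)
    (hnc : NowhereConstant f) {η : ℝ} (hη : 0 < η) (hηδ : η ≤ D.δ) (x : Λ) {α : ℕ → D.I}
    (hα : D.IsCode η x α) {A B C R : ℕ} (hq : S.IsQuasigeodesicSeq A B C (D.ray α))
    {r : S.GeodesicRay} (hr : S.HausdorffClose R (range (D.ray α)) (range r.1)) :
    f x = S.endpoint r := by
  by_contra hne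
  obtain ⟨V, hVo, hxV, hV⟩ := hE.exists_isOpen_contracting R hne
  obtain ⟨ε, hε, hεV⟩ := Metric.isOpen_iff.1 (hVo.preimage hcont) x hxV
  obtain ⟨p, hp, φ, hφ, hlim⟩ := hcomp.tendsto_subseq
    (x := fun i => D.orbit α x (i + 1)) (fun i => D.orbit_mem hinv α x.2 (i + 1))
  -- Nowhere constancy is used at a limit point of the orbit, so one pair `p`, `y` serves for
  -- infinitely many elements of the ray.
  obtain ⟨y, hy, hyp⟩ : ∃ y ∈ Metric.ball (⟨p, hp⟩ : Λ) (η / 2), f y ≠ f ⟨p, hp⟩ := by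
    by_contra! h
    have hmem : (⟨p, hp⟩ : Λ) ∈ Metric.ball (⟨p, hp⟩ : Λ) (η / 2) :=
      Metric.mem_ball_self (by linarith)
    refine hnc _ Metric.isOpen_ball ⟨_, hmem⟩ (f ⟨p, hp⟩) ?_
    refine Subset.antisymm ?_ (singleton_subset_iff.2 ⟨_, hmem, rfl⟩)
    rintro _ ⟨y, hy, rfl⟩
    exact h y hy
  refine hyp (hE.eq_of_forall_productGE fun N => ?_)
  obtain ⟨m₀, hm₀⟩ := hV N
  have hsmall : ∀ᶠ i in atTop, D.L * η / D.lam ^ (φ i) < ε := by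
    have h : Tendsto (fun i => D.L * η / D.lam ^ i) atTop (𝓝 0) :=
      (tendsto_pow_atTop_atTop_of_one_lt D.one_lt_lam).const_div_atTop _
    exact hφ.tendsto_atTop.eventually (h.eventually (gt_mem_nhds hε))
  have hnear : ∀ᶠ i in atTop, dist (D.orbit α x (φ i + 1)) p < η / 2 :=
    hlim.eventually (Metric.ball_mem_nhds p (by linarith))
  obtain ⟨i, hi, hi', hi''⟩ := (hsmall.and (hnear.and (hφ.tendsto_atTop.eventually
    (eventually_gt_atTop (A * (m₀ + R + S.wdist (r.1 0) (D.ray α 0)) + C))))).exists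
  set g := D.ray α (φ i) with hg
  obtain ⟨_, ⟨m, rfl⟩, hm⟩ := hr.1 g ⟨φ i, rfl⟩
  -- A late element of the quasigeodesic is far from its start, so the point of `r` near it is late
  -- too.
  have hmm : m₀ ≤ m := by
    by_contra! hlt
    have h1 := hq.lower 0 (φ i) (Nat.zero_le _)
    rw [← hg] at h1
    have h2 := S.wdist_triangle (D.ray α 0) (r.1 0) g
    have h3 := S.wdist_triangle (r.1 0) (r.1 m) g
    rw [r.2 0 m (Nat.zero_le m), S.wdist_comm (r.1 m)] at h3
    rw [S.wdist_comm (D.ray α 0) (r.1 0)] at h2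
    have h4 : S.wdist (D.ray α 0) g ≤ m₀ + R + S.wdist (r.1 0) (D.ray α 0) := by omega
    have h5 := Nat.mul_le_mul_left A h4
    omega
  -- Points within `η / 2` of `p` are within `η` of the orbit point, so `ρ g` moves them to within
  -- `ε` of `x`. Contraction by `g⁻¹` then makes the product of `f y` and `f p` exceed any `N`.
  have himage : ∀ z : Λ, dist (z : M) p < η / 2 → g • f z ∈ V := by
    intro z hz
    have h1 : dist (z : M) (D.orbit α x (φ i + 1)) < η := by
      have := dist_triangle_right (z : M) (D.orbit α x (φ i + 1)) p
      linarith
    have h2 := (hα.dist_ray_apply_lt hinv hηδ x.2 (φ i) η le_rfl z h1).trans hi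
    rw [← hequiv g z ⟨ρ g z, apply_mem hinv g z.2⟩ rfl]
    exact hεV h2
  have h := hm₀ m hmm g hm _ (himage y hy) _
    (himage ⟨p, hp⟩ (by rw [dist_self]; linarith))
  rwa [inv_smul_smul, inv_smul_smul] at h

/-! ### Shrinking the datum: S-hyperbolic implies meandering-hyperbolic. -/

theorem rays_mono {D : ExpansionDatum ρ Λ} {η η' : ℝ} (h : η ≤ η') (x : M) :
    D.rays η' x ⊆ D.rays η x := by
  rintro _ ⟨α, hα, rfl⟩
  exact ⟨α, fun i hi => (Metric.ball_subset_ball h).trans (hα i hi), rfl⟩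

/-- The same expansion datum with a smaller Lebesgue number. -/
def shrink (D : ExpansionDatum ρ Λ) (δ' : ℝ) (h0 : 0 < δ') (h : δ' ≤ D.δ) :
    ExpansionDatum ρ Λ where
  I := D.I
  finite_I := D.finite_I
  U := D.U
  isOpen_U := D.isOpen_U
  subset_iUnion := D.subset_iUnion
  s := D.s
  L := D.L
  lam := D.lam
  δ := δ'
  lam_le_L := D.lam_le_L
  one_lt_lam := D.one_lt_lam
  δ_pos := h0
  lebesgue x hx := (D.lebesgue x hx).imp fun _ ha => (Metric.ball_subset_ball h).trans ha
  lipschitz a x hx y hy := D.lipschitz a x (Metric.thickening_mono h Λ hx) y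
    (Metric.thickening_mono h Λ hy)
  expanding a := ⟨(D.expanding a).1, fun x η hη => (D.expanding a).2 x η (hη.trans h)⟩
  symmetric := D.symmetric
  generates := D.generates

theorem rays_shrink (D : ExpansionDatum ρ Λ) {δ' : ℝ} (h0 : 0 < δ') (h : δ' ≤ D.δ) (η : ℝ)
    (x : M) : (D.shrink δ' h0 h).rays η x = D.rays η x := by
  have horb : ∀ (α : ℕ → D.I) (i : ℕ), (D.shrink δ' h0 h).orbit α x i = D.orbit α x i := by
    intro α i
    induction i with
    | zero => rfl
    | succ i ih =>
      change ρ (D.s (α i))⁻¹ ((D.shrink δ' h0 h).orbit α x i) = _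
      rw [ih]
      rfl
  have hray : ∀ (α : ℕ → D.I) (i : ℕ), (D.shrink δ' h0 h).ray α i = D.ray α i := by
    intro α i
    induction i with
    | zero => rfl
    | succ i ih =>
      change (D.shrink δ' h0 h).ray α i * D.s (α (i + 1)) = _
      rw [ih]
      rfl
  ext c
  constructor
  · rintro ⟨α, hα, rfl⟩
    exact ⟨α, fun i hi => horb α i ▸ hα i hi, funext fun i => (hray α i).symm⟩
  · rintro ⟨α, hα, rfl⟩
    exact ⟨α, fun i hi => by rw [horb]; exact hα i hi, funext fun i => hray α i⟩

theorem IsUniformlySHyperbolic.isSHyperbolic {D : ExpansionDatum ρ Λ}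
    (h : D.IsUniformlySHyperbolic) : D.IsSHyperbolic :=
  let ⟨N, hN, H⟩ := h
  ⟨N, hN, H D.δ D.δ_pos le_rfl⟩

/-- A refinement needs a strictly smaller `δ`, so `δ` is halved and all else kept. Fellow-travelling
rays are related by `Approx` in one step, with all indices as the infinite sets. -/
theorem IsSHyperbolic.isMeanderingHyperbolic {D : ExpansionDatum ρ Λ}
    (h : D.IsSHyperbolic) : D.IsMeanderingHyperbolic := by
  obtain ⟨N, hN, H⟩ := h
  have hpos := D.δ_pos
  have hsub : ∀ x, D.rays D.δ x ⊆
      (D.shrink (D.δ / 2) (by linarith) (by linarith)).rays (D.δ / 2) x := by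
    intro x
    rw [rays_shrink]
    exact rays_mono (by linarith) x
  refine ⟨D.shrink (D.δ / 2) (by linarith) (by linarith), N,
    ⟨⟨id, Function.injective_id, fun _ => rfl, fun _ => Subset.rfl⟩, half_lt_self hpos,
      le_rfl, le_rfl⟩, hN, fun x hx c hc c' hc' => ?_⟩
  refine ⟨hsub x hc, hsub x hc', Relation.EqvGen.rel _ _
    ⟨univ, univ, infinite_univ, infinite_univ, ?_⟩⟩
  rw [image_univ, image_univ]
  exact H x hx c hc c' hc'

end ExpansionDatum
end ExpHyp

/-! ### The main theorem. -/

theorem theorem6p1 {Γ M : Type*} [Group Γ] [MetricSpace M] [ProperSpace M]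
    -- a non-elementary hyperbolic group, with a hyperbolic Cayley graph that defines its boundary
    (S : ExpHyp.FiniteGeneratingSet Γ) (hS : S.IsHyperbolic) (hΓ : ¬ ExpHyp.IsElementary Γ)
    -- an action on `M` with a nonempty invariant compact set, no point of which is isolated in `M`
    (ρ : Γ →* (M ≃ₜ M)) (Λ : Set M) (hne : Λ.Nonempty) (hcomp : IsCompact Λ)
    (hinv : ∀ g, ρ g '' Λ = Λ) (hiso : ∀ x ∈ Λ, ¬ IsOpen ({x} : Set M))
    -- the action is expanding, with the datum `D`
    (D : ExpHyp.ExpansionDatum ρ Λ)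
    (f : Λ → S.Boundary) (hcont : Continuous f)
    (hequiv : ∀ (g : Γ) (x y : Λ), ρ g x = y → f y = g • f x)
    (hnc : ExpHyp.NowhereConstant f) :
    D.IsUniformlySHyperbolic ∧ D.IsSHyperbolic ∧ D.IsMeanderingHyperbolic ∧
      D.IsCodingMap S f := by
  obtain ⟨d, hd⟩ := hS
  have hE := hd.fourPoint
  set E := 6 * d + 2
  obtain ⟨A, B, hAB⟩ := D.exists_isQuasigeodesicSeq S hinv hiso
  obtain ⟨R, hR⟩ := hE.exists_geodesicRay A B 0
  obtain ⟨K, hK⟩ := S.exists_wdist_le_mul D.gens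
  obtain ⟨K', hK'⟩ := D.gens.exists_wdist_le_mul S
  have key : ∀ η, 0 < η → η ≤ D.δ → ∀ x : Λ, ∀ α, D.IsCode η x α →
      ∃ r : S.GeodesicRay, r.1 0 = D.ray α 0 ∧ S.endpoint r = f x ∧
        S.HausdorffClose R (range (D.ray α)) (range r.1) := by
    intro η hη hηδ x α hα
    have hq := hAB η hη x x.2 α hα
    obtain ⟨r, hr0, hr⟩ := hR _ hq
    exact ⟨r, hr0, (hα.eq_endpoint hE hcomp hinv hcont hequiv hnc hη hηδ x hq hr).symm, hr⟩
  have huniform : D.IsUniformlySHyperbolic := by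
    -- From a ray to its geodesic, across to the other geodesic, and back to the other ray; `K'`
    -- converts to the word metric of `D`, and the summand 1 ensures `1 ≤ N`.
    refine ⟨K' * (R + (4 * K + 2 * E) + R) + 1, by omega, ?_⟩
    rintro η hη hηδ x hx _ ⟨α, hα, rfl⟩ _ ⟨β, hβ, rfl⟩
    obtain ⟨r, hr0, hrf, hr⟩ := key η hη hηδ ⟨x, hx⟩ α hα
    obtain ⟨r', hr0', hrf', hr'⟩ := key η hη hηδ ⟨x, hx⟩ β hβ
    obtain ⟨N, hN⟩ := ExpHyp.FiniteGeneratingSet.endpoint_eq_iff.1 (hrf.trans hrf'.symm)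
    -- Both geodesics start at generators of `D`, each within `K` of the identity for `S`.
    have hstart : S.wdist (r.1 0) (r'.1 0) ≤ 2 * K := by
      rw [hr0, hr0']
      have h1 := Nat.mul_le_mul_left K (D.wdist_one_ray_zero_le α)
      have h2 := Nat.mul_le_mul_left K (D.wdist_one_ray_zero_le β)
      have h3 := hK 1 (D.ray α 0)
      have h4 := hK 1 (D.ray β 0)
      have h5 := S.wdist_triangle (D.ray α 0) 1 (D.ray β 0)
      rw [S.wdist_comm (D.ray α 0) 1] at h5
      omega
    have hrr := (hE.hausdorffClose_of_asymptotic hN).mono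
      (show _ ≤ 4 * K + 2 * E by omega)
    exact (((hr.trans S hrr).trans S (hr'.symm S)).of_wdist_le hK').mono (Nat.le_succ _)
  refine ⟨huniform, huniform.isSHyperbolic, huniform.isSHyperbolic.isMeanderingHyperbolic, ?_⟩
  rintro x _ ⟨α, hα, rfl⟩
  obtain ⟨r, -, hrf, hr⟩ := key D.δ D.δ_pos le_rfl x α hα
  exact ⟨(hAB D.δ D.δ_pos x x.2 α hα).isQuasigeodesicRay, r, hrf, R, hr⟩
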